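/- Let $N\ge 0$, $n\ge 1$, $A\in\mathbb C^{N\times N}$ (possibly singular), $b,x_0\in\mathbb C^N$ and $q_1,\dots,q_n\in\mathbb C^N$. For $k\ge1$ put $g_n(k)=\lfloor (k-1)/n\rfloor$, $r_n(k)=k-n\,g_n(k)\in\{1,\dots,n\}$ and $p_k=(A^H)^{g_n(k)}q_{r_n(k)}$. Let $r_0=b-Ax_0$, let $\nu$ be the degree of the minimal polynomial of $r_0$ with respect to $A$ (the monic polynomial $p$ of least degree with $p(A)r_0=0$), and for $1\le l\le\nu$ let $$\widehat S_l=[p_1,\dots,p_l]^HA[r_0,Ar_0,\dots,A^{l-1}r_0],\qquad \widehat W_l=[p_1,\dots,p_l]^H[r_0,Ar_0,\dots,A^{l-1}r_0].$$ Write $\mathcal K_t(A,v)=\mathrm{span}\{v,Av,\dots,A^{t-1}v\}$, $\sigma(A)$ for the spectrum of $A$, and $u\perp v$ if $u^Hv=0$. Consider the following algorithm (ML($n$)BiCGStab) in exact arithmetic; empty loops are skipped. Set $g_0=r_0$, $w_0=Ag_0$, $c_0=q_1^Hw_0$. For $k=1,2,\dots$, until $r_k=0$, with $j=g_n(k)$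 and $i=r_n(k)$, carry out the following two steps. *Step 1.* If $i=1$: $\alpha_k=q_1^Hr_{k-1}/c_{k-1}$; $u_k=r_{k-1}-\alpha_kw_{k-1}$; $x_k=x_{k-1}+\alpha_kg_{k-1}$. If $u_k=0$, stop with this $x_k$ and put $r_k=u_k$. Otherwise $\rho_{j+1}=-(Au_k)^Hu_k/\|Au_k\|_2^2$; $x_k\leftarrow x_k-\rho_{j+1}u_k$; $r_k=\rho_{j+1}Au_k+u_k$. If $i>1$: $\tilde\alpha_k=q_i^Hu_{k-1}/c_{k-1}$; if $i<n$, $u_k=u_{k-1}-\tilde\alpha_kd_{k-1}$; $x_k=x_{k-1}+\rho_{j+1}\tilde\alpha_kg_{k-1}$; $r_k=r_{k-1}-\rho_{j+1}\tilde\alpha_kw_{k-1}$. *Step 2.* If $i<n$: start with $z_d=u_k$, $g_k=0$, $z_w=0$. If $j\ge1$, for $s=k-n,\dots,jn-1$: $\beta=-q_{r_n(s+1)}^Hz_d/c_s$, $z_d\leftarrow z_d+\beta d_s$, $g_k\leftarrow g_k+\beta g_s$, $z_w\leftarrow z_w+\beta w_s$. Then $z_w\leftarrow r_k+\rho_{j+1}z_w$;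 $\tilde\beta=-q_1^Hz_w/c_{jn}$; $z_w\leftarrow z_w+\tilde\beta w_{jn}$; $g_k\leftarrow g_k+z_w+(\tilde\beta/\rho_{j+1})g_{jn}$. For $s=jn+1,\dots,k-1$: $\beta=-q_{r_n(s+1)}^Hz_w/c_s$, $g_k\leftarrow g_k+\beta g_s$, $z_w\leftarrow z_w+\beta d_s$. Finally $d_k=z_w-u_k$, $c_k=q_{r_n(k+1)}^Hd_k$, $w_k=Ag_k$. If $i=n$: $\tilde\beta=-q_1^Hr_k/c_{jn}$; $z_w=r_k+\tilde\beta w_{jn}$; $g_k=z_w+(\tilde\beta/\rho_{j+1})g_{jn}$. For $s=jn+1,\dots,k-1$: $\beta=-q_{r_n(s+1)}^Hz_w/c_s$, $g_k\leftarrow g_k+\beta g_s$, $z_w\leftarrow z_w+\beta d_s$. Finally $w_k=Ag_k$, $c_k=q_{r_n(k+1)}^Hw_k$. **Proposition.** Suppose that $\prod_{l=1}^{\nu}\det(\widehat S_l)\det(\widehat W_l)\neq0$ and that, for each $1\le k\le\nu-1$, the value $\rho_{g_n(k)+1}$ in use in iteration $k$ (whenever the algorithm gets as far as having it after Step 1 of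 that iteration, without a division by zero or a stop) satisfies $\rho_{g_n(k)+1}\ne0$ and $-1/\rho_{g_n(k)+1}\notin\sigma(A)$. Then no division by zero occurs in iterations $1,\dots,\nu$, the algorithm stops at iteration $\nu$ and not earlier, and $Ax_\nu=b$. Moreover, the computed quantities satisfy: (a) for $1\le k\le\nu-1$: $x_k\in x_0+\mathcal K_{g_n(k)+k+1}(A,r_0)$ and $r_k=b-Ax_k\in r_0+A\,\mathcal K_{g_n(k)+k+1}(A,r_0)$; (b) $r_k\ne0$ for $1\le k\le\nu-1$, and $r_\nu=0$; (c) $r_k\not\perp q_1$ for $1\le k\le\nu-1$ with $r_n(k)=n$; (d) $u_k\perp\mathrm{span}\{q_1,\dots,q_{r_n(k)}\}$ and $u_k\not\perp q_{r_n(k)+1}$ for $1\le k\le\nu-1$ with $r_n(k)<n$; (e) $d_k\perp\mathrm{span}\{q_1,\dots,q_{r_n(k)}\}$ and $d_k\not\perp q_{r_n(k)+1}$ for $1\le k\le\nu-1$ with $r_n(k)<n$. -/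

import Mathlib

open scoped Matrix

noncomputable section

namespace MLBiCGStab

/-- Column vectors of length `N` over the complex numbers. -/
abbrev Vec (N : ℕ) : Type := Fin N → ℂ

/-- The scalar `pᴴ v`. -/
def hdot {N : ℕ} (p v : Vec N) : ℂ := star p ⬝ᵥ v

/-- The index function `g_n(k) = ⌊(k - 1) / n⌋`, for `k ≥ 1`. -/
def gIdx (n k : ℕ) : ℕ := (k - 1) / n

/-- The index function `r_n(k) = k - n g_n(k)`, for `k ≥ 1`; it takes values in `{1, …, n}`. -/
def rIdx (n k : ℕ) : ℕ := k - n * gIdx n k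

/-- The Krylov space `K_t(M, v) = span {v, M v, …, M ^ (t - 1) v}`. -/
def krylov {N : ℕ} (M : Matrix (Fin N) (Fin N) ℂ) (v : Vec N) (t : ℕ) : Submodule ℂ (Vec N) :=
  Submodule.span ℂ {y | ∃ i : ℕ, i < t ∧ y = (M ^ i) *ᵥ v}

/-- The degree of the minimal polynomial of the vector `v` with respect to `M`: the least degree
of a monic polynomial `p` with `p(M) v = 0`. -/
def minPolyDegree {N : ℕ} (M : Matrix (Fin N) (Fin N) ℂ) (v : Vec N) : ℕ :=
  sInf {m | ∃ p : Polynomial ℂ, p.Monic ∧ p.natDegree = m ∧ (Polynomial.aeval M p) *ᵥ v = 0}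

/-- The least degree is attained, so that the infimum above is a minimum. -/
theorem minPolyDegree_mem {N : ℕ} (M : Matrix (Fin N) (Fin N) ℂ) (v : Vec N) :
    ∃ p : Polynomial ℂ, p.Monic ∧ p.natDegree = minPolyDegree M v ∧
      (Polynomial.aeval M p) *ᵥ v = 0 := by
  have h : {m | ∃ p : Polynomial ℂ, p.Monic ∧ p.natDegree = m ∧
      (Polynomial.aeval M p) *ᵥ v = 0}.Nonempty :=
    ⟨_, M.charpoly, M.charpoly_monic, rfl, by simp [Matrix.aeval_self_charpoly]⟩
  exact Nat.sInf_mem h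

/-- The left vectors `p_k = (Aᴴ) ^ g_n(k) q_{r_n(k)}`, for `k ≥ 1`. -/
def leftVec {N : ℕ} (n : ℕ) (A : Matrix (Fin N) (Fin N) ℂ) (q : ℕ → Vec N) (k : ℕ) : Vec N :=
  (Aᴴ ^ gIdx n k) *ᵥ q (rIdx n k)

/-- The moment matrix `[p_1, …, p_l]ᴴ A [r, A r, …, A ^ (l - 1) r]`. -/
def momentS {N : ℕ} (n : ℕ) (A : Matrix (Fin N) (Fin N) ℂ) (q : ℕ → Vec N) (r : Vec N) (l : ℕ) :
    Matrix (Fin l) (Fin l) ℂ :=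
  Matrix.of fun i j => hdot (leftVec n A q ((i : ℕ) + 1)) (A *ᵥ ((A ^ (j : ℕ)) *ᵥ r))

/-- The moment matrix `[p_1, …, p_l]ᴴ [r, A r, …, A ^ (l - 1) r]`. -/
def momentW {N : ℕ} (n : ℕ) (A : Matrix (Fin N) (Fin N) ℂ) (q : ℕ → Vec N) (r : Vec N) (l : ℕ) :
    Matrix (Fin l) (Fin l) ℂ :=
  Matrix.of fun i j => hdot (leftVec n A q ((i : ℕ) + 1)) ((A ^ (j : ℕ)) *ᵥ r)

/-- Division that fails, with value `none`, when the divisor is zero. -/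
def safeDiv (a b : ℂ) : Option ℂ :=
  open Classical in if b = 0 then none else some (a / b)

/-- The loop `for s = a, …, e - 1` over a body that may break down; empty loops are skipped. -/
def forLoop {α : Type} (a e : ℕ) (body : ℕ → α → Option α) (init : α) : Option α :=
  (List.range' a (e - a)).foldlM (fun acc s => body s acc) init

/-- The quantities `x_k, r_k, u_k, g_k, w_k, d_k, c_k, ρ_k` computed so far (entries that have not
been computed are `0`), and whether the algorithm has stopped. -/
structure State (N : ℕ) where
  x : ℕ → Vec N
  r : ℕ → Vec N
  u : ℕ → Vec N
  g : ℕ → Vec N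
  w : ℕ → Vec N
  d : ℕ → Vec N
  c : ℕ → ℂ
  ρ : ℕ → ℂ
  stopped : Prop

/-- The initialization from the initial guess `x₀`. -/
def initState {N : ℕ} (A : Matrix (Fin N) (Fin N) ℂ) (b x₀ : Vec N) (q : ℕ → Vec N) : State N where
  x := Function.update 0 0 x₀
  r := Function.update 0 0 (b - A *ᵥ x₀)
  u := 0
  g := Function.update 0 0 (b - A *ᵥ x₀)
  w := Function.update 0 0 (A *ᵥ (b - A *ᵥ x₀))
  d := 0
  c := Function.update 0 0 (hdot (q 1) (A *ᵥ (b - A *ᵥ x₀)))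
  ρ := 0
  stopped := b - A *ᵥ x₀ = 0

/-- First half of iteration `k`: the new iterate and its residual. If `r_n(k) = 1` and `u_k = 0`,
then `x_{k-1} + α_k g_{k-1}`, whose residual is `u_k`, is accepted as `x_k` and the algorithm stops
at once, before `ρ_{g_n(k)+1}` is computed; in that case `r_k` records this residual. -/
def residualHalf {N : ℕ} (n : ℕ) (A : Matrix (Fin N) (Fin N) ℂ) (q : ℕ → Vec N) (k : ℕ)
    (st : State N) : Option (State N) :=
  open Classical in
  if rIdx n k = 1 then do
    let α ← safeDiv (hdot (q (rIdx n k)) (st.r (k - 1))) (st.c (k - 1))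
    let uk := st.r (k - 1) - α • st.w (k - 1)
    let xk := st.x (k - 1) + α • st.g (k - 1)
    if uk = 0 then
      some { st with
        x := Function.update st.x k xk
        u := Function.update st.u k uk
        r := Function.update st.r k uk
        stopped := True }
    else do
      let ρk ← safeDiv (-(hdot (A *ᵥ uk) uk)) (((‖WithLp.toLp 2 (A *ᵥ uk)‖ ^ 2 : ℝ)) : ℂ)
      some { st with
        x := Function.update st.x k (xk - ρk • uk)
        u := Function.update st.u k uk
        r := Function.update st.r k (ρk • (A *ᵥ uk) + uk)
        ρ := Function.update st.ρ (gIdx n k + 1) ρk }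
  else do
    let α ← safeDiv (hdot (q (rIdx n k)) (st.u (k - 1))) (st.c (k - 1))
    let ρk := st.ρ (gIdx n (k - 1) + 1)
    some { st with
      u := if rIdx n k < n then Function.update st.u k (st.u (k - 1) - α • st.d (k - 1)) else st.u
      x := Function.update st.x k (st.x (k - 1) + (ρk * α) • st.g (k - 1))
      r := Function.update st.r k (st.r (k - 1) - (ρk * α) • st.w (k - 1)) }

/-- Second half of iteration `k`: the new direction vectors. The convergence test
`r_k = 0` is made at the end of the iteration. -/
def directionHalf {N : ℕ} (n : ℕ) (A : Matrix (Fin N) (Fin N) ℂ) (q : ℕ → Vec N) (k : ℕ)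
    (st : State N) : Option (State N) :=
  let j := gIdx n k
  let ρk := st.ρ (j + 1)
  if rIdx n k < n then do
    -- the accumulator is `(z_d, g_k, z_w)`
    let acc₁ : Vec N × Vec N × Vec N ←
      if 1 ≤ j then
        forLoop (k - n) (j * n)
          (fun s (acc : Vec N × Vec N × Vec N) => do
            let β ← safeDiv (-(hdot (q (rIdx n (s + 1))) acc.1)) (st.c s)
            some (acc.1 + β • st.d s, acc.2.1 + β • st.g s, acc.2.2 + β • st.w s))
          (st.u k, 0, 0)
      else some (st.u k, 0, 0)
    let zw₁ := st.r k + ρk • acc₁.2.2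
    let βt ← safeDiv (-(hdot (q 1) zw₁)) (st.c (j * n))
    let zw₂ := zw₁ + βt • st.w (j * n)
    let βq ← safeDiv βt ρk
    let gk₂ := acc₁.2.1 + zw₂ + βq • st.g (j * n)
    -- the accumulator is `(g_k, z_w)`
    let acc₂ : Vec N × Vec N ←
      forLoop (j * n + 1) k
        (fun s (acc : Vec N × Vec N) => do
          let β ← safeDiv (-(hdot (q (rIdx n (s + 1))) acc.2)) (st.c s)
          some (acc.1 + β • st.g s, acc.2 + β • st.d s))
        (gk₂, zw₂)
    let dk := acc₂.2 - st.u k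
    some { st with
      g := Function.update st.g k acc₂.1
      d := Function.update st.d k dk
      c := Function.update st.c k (hdot (q (rIdx n (k + 1))) dk)
      w := Function.update st.w k (A *ᵥ acc₂.1)
      stopped := st.r k = 0 }
  else do
    let βt ← safeDiv (-(hdot (q 1) (st.r k))) (st.c (j * n))
    let zw₁ := st.r k + βt • st.w (j * n)
    let βq ← safeDiv βt ρk
    let gk₁ := zw₁ + βq • st.g (j * n)
    -- the accumulator is `(g_k, z_w)`
    let acc : Vec N × Vec N ←
      forLoop (j * n + 1) k
        (fun s (acc : Vec N × Vec N) => do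
          let β ← safeDiv (-(hdot (q (rIdx n (s + 1))) acc.2)) (st.c s)
          some (acc.1 + β • st.g s, acc.2 + β • st.d s))
        (gk₁, zw₁)
    some { st with
      g := Function.update st.g k acc.1
      w := Function.update st.w k (A *ᵥ acc.1)
      c := Function.update st.c k (hdot (q (rIdx n (k + 1))) (A *ᵥ acc.1))
      stopped := st.r k = 0 }

/-- Execute `f` unless the algorithm has already stopped. -/
def unlessStopped {N : ℕ} (f : State N → Option (State N)) (st : State N) : Option (State N) :=
  open Classical in if st.stopped then some st else f st

/-- The state of the ML(n)BiCGStab algorithm after iteration `k`; the value is `none` if a division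
by zero has occurred. -/
def run {N : ℕ} (n : ℕ) (A : Matrix (Fin N) (Fin N) ℂ) (b x₀ : Vec N) (q : ℕ → Vec N) :
    ℕ → Option (State N)
  | 0 => some (initState A b x₀ q)
  | k + 1 => ((run n A b x₀ q k).bind (unlessStopped (residualHalf n A q (k + 1)))).bind
      (unlessStopped (directionHalf n A q (k + 1)))

/-- The state after the first half of iteration `k ≥ 1`, when `ρ_{g_n(k)+1}` has been computed. -/
def runHalf {N : ℕ} (n : ℕ) (A : Matrix (Fin N) (Fin N) ℂ) (b x₀ : Vec N) (q : ℕ → Vec N)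
    (k : ℕ) : Option (State N) :=
  (run n A b x₀ q (k - 1)).bind (unlessStopped (residualHalf n A q k))

end MLBiCGStab

end

open MLBiCGStab

/-! ### Moments against the left vectors, and Krylov spaces -/

namespace MLBiCGStab

variable {N : ℕ}

/-! The algorithm is a disguised biorthogonalization. Behind the computed entries stand vectors `R_s
∈ r₀ + A K_s` and `G_s ∈ R_s + K_s` such that `R_s` and `A G_s` are orthogonal to `p_1, …, p_s`.
With `Φ_j = (1 + ρ₁ A) ⋯ (1 + ρ_j A)` (`stab`), the entries are `r_s = Φ_⌈s/n⌉ R_s`, `g_s = Φ_⌈s/n⌉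
G_s`, `w_s = A g_s` and, for `n ∤ s`, `u_s = Φ_⌊s/n⌋ R_s` and `d_s = ρ_{⌊s/n⌋+1} Φ_⌊s/n⌋ A G_s`.
These relations (`IsResidual`, `IsDirection`) are the invariant of the iteration.

The algorithm only tests against `q_1, …, q_n`. If `v` is orthogonal to `p_1, …, p_s`, all lower
powers of `A` in `Φ_⌊s/n⌋` drop out, and testing `Φ_⌊s/n⌋ v` against `q_{s % n + 1}` gives a nonzero
multiple of `p_{s+1}ᴴ v` (`hdot_stab_mulVec_moment`). So each coefficient of the algorithm enforces
exactly one further orthogonality relation (`residual_succ_orth`, `orth_step`).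

The determinants exclude breakdown: those of `W` give `p_{s+1}ᴴ R_s ≠ 0`, and together with those of
`S` they give `p_{s+1}ᴴ A G_s ≠ 0`, hence `c_s ≠ 0`. The spectral condition makes `Φ_j` invertible,
so no residual vanishes before step `ν`. At step `ν` the vector `R_ν` lies in `K_{ν+1} = K_ν` and
has `ν` vanishing moments, so it is zero. -/

theorem hdot_add (p v w : Vec N) : hdot p (v + w) = hdot p v + hdot p w :=
  dotProduct_add _ _ _

theorem hdot_sub (p v w : Vec N) : hdot p (v - w) = hdot p v - hdot p w :=
  dotProduct_sub _ _ _

theorem hdot_smul (p : Vec N) (a : ℂ) (v : Vec N) : hdot p (a • v) = a * hdot p v := by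
  simp [hdot, dotProduct_smul]

theorem hdot_zero (p : Vec N) : hdot p 0 = 0 := dotProduct_zero _

theorem hdot_sum {ι : Type*} (s : Finset ι) (p : Vec N) (f : ι → Vec N) :
    hdot p (∑ i ∈ s, f i) = ∑ i ∈ s, hdot p (f i) := by
  simp only [hdot, dotProduct_sum]

theorem star_hdot (p v : Vec N) : star (hdot p v) = hdot v p :=
  (Matrix.star_dotProduct v p).symm

theorem hdot_eq_zero_comm (p v : Vec N) : hdot p v = 0 ↔ hdot v p = 0 := by
  rw [← star_hdot, star_eq_zero]

theorem hdot_conjTranspose_mulVec (M : Matrix (Fin N) (Fin N) ℂ) (p v : Vec N) :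
    hdot (Mᴴ *ᵥ p) v = hdot p (M *ᵥ v) := by
  simp only [hdot, Matrix.star_mulVec, Matrix.conjTranspose_conjTranspose, Matrix.dotProduct_mulVec]

theorem hdot_eq_zero_of_mem_span {u v : Vec N} {S : Set (Vec N)} (h : ∀ p ∈ S, hdot p u = 0)
    (hv : v ∈ Submodule.span ℂ S) : hdot u v = 0 := by
  induction hv using Submodule.span_induction with
  | mem x hx => exact (hdot_eq_zero_comm _ _).1 (h x hx)
  | zero => exact hdot_zero u
  | add x y _ _ hx hy => rw [hdot_add, hx, hy, add_zero]
  | smul a x _ hx => rw [hdot_smul, hx, mul_zero]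

theorem gIdx_succ (n s : ℕ) : gIdx n (s + 1) = s / n := rfl

theorem rIdx_succ (n s : ℕ) : rIdx n (s + 1) = s % n + 1 := by
  have h := Nat.div_add_mod s n
  simp only [rIdx, gIdx, Nat.add_sub_cancel]
  omega

/-- The moment `p_{s+1}ᴴ v`. -/
def moment (n : ℕ) (A : Matrix (Fin N) (Fin N) ℂ) (q : ℕ → Vec N) (s : ℕ) (v : Vec N) : ℂ :=
  hdot (q (s % n + 1)) ((A ^ (s / n)) *ᵥ v)

variable {n : ℕ} {A : Matrix (Fin N) (Fin N) ℂ} {q : ℕ → Vec N}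

theorem hdot_leftVec (s : ℕ) (v : Vec N) :
    hdot (leftVec n A q (s + 1)) v = moment n A q s v := by
  rw [leftVec, gIdx_succ, rIdx_succ, ← Matrix.conjTranspose_pow, hdot_conjTranspose_mulVec, moment]

theorem moment_add (s : ℕ) (v w : Vec N) :
    moment n A q s (v + w) = moment n A q s v + moment n A q s w := by
  simp only [moment, Matrix.mulVec_add, hdot_add]

theorem moment_sub (s : ℕ) (v w : Vec N) :
    moment n A q s (v - w) = moment n A q s v - moment n A q s w := by
  simp only [moment, Matrix.mulVec_sub, hdot_sub]

theorem moment_smul (s : ℕ) (a : ℂ) (v : Vec N) :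
    moment n A q s (a • v) = a * moment n A q s v := by
  simp only [moment, Matrix.mulVec_smul, hdot_smul]

theorem moment_sum {ι : Type*} (s : ℕ) (S : Finset ι) (f : ι → Vec N) :
    moment n A q s (∑ i ∈ S, f i) = ∑ i ∈ S, moment n A q s (f i) := by
  simp only [moment, Matrix.mulVec_sum, hdot_sum]

/-- Because `p_{s+n} = Aᴴ p_s`. Hence `A R` inherits all but the last `n` orthogonality relations of
`R`, which is why only `n` directions enter each recurrence. -/
theorem moment_mulVec (hn : 1 ≤ n) (s : ℕ) (v : Vec N) :
    moment n A q s (A *ᵥ v) = moment n A q (s + n) v := by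
  simp only [moment, Matrix.mulVec_mulVec, ← pow_succ, Nat.add_mod_right,
    Nat.add_div_right s (show 0 < n by omega)]

theorem mem_krylov_iff {r v : Vec N} {l : ℕ} :
    v ∈ krylov A r l ↔ ∃ a : Fin l → ℂ, ∑ j, a j • ((A ^ (j : ℕ)) *ᵥ r) = v := by
  have : {y | ∃ i : ℕ, i < l ∧ y = (A ^ i) *ᵥ r} =
      Set.range fun j : Fin l => (A ^ (j : ℕ)) *ᵥ r := by
    ext y
    constructor
    · rintro ⟨i, hi, rfl⟩
      exact ⟨⟨i, hi⟩, rfl⟩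
    · rintro ⟨i, rfl⟩
      exact ⟨i, i.2, rfl⟩
  rw [krylov, this, Submodule.mem_span_range_iff_exists_fun]

theorem krylov_mono (r : Vec N) {l m : ℕ} (h : l ≤ m) : krylov A r l ≤ krylov A r m :=
  Submodule.span_mono fun _ ⟨i, hi, hy⟩ => ⟨i, hi.trans_le h, hy⟩

theorem pow_mulVec_mem_krylov (r : Vec N) {i l : ℕ} (h : i < l) : (A ^ i) *ᵥ r ∈ krylov A r l :=
  Submodule.subset_span ⟨i, h, rfl⟩

theorem self_mem_krylov (r : Vec N) {l : ℕ} (h : 0 < l) : r ∈ krylov A r l := by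
  simpa using pow_mulVec_mem_krylov (A := A) r h

theorem mulVec_mem_krylov {r v : Vec N} {l : ℕ} (h : v ∈ krylov A r l) :
    A *ᵥ v ∈ krylov A r (l + 1) := by
  induction h using Submodule.span_induction with
  | mem x hx =>
    obtain ⟨i, hi, rfl⟩ := hx
    rw [Matrix.mulVec_mulVec, ← pow_succ']
    exact pow_mulVec_mem_krylov r (by omega)
  | zero => simp
  | add x y _ _ hx hy => rw [Matrix.mulVec_add]; exact add_mem hx hy
  | smul a x _ hx => rw [Matrix.mulVec_smul]; exact Submodule.smul_mem _ _ hx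

theorem eq_zero_of_mem_krylov_zero {r v : Vec N} (h : v ∈ krylov A r 0) : v = 0 := by
  obtain ⟨a, rfl⟩ := mem_krylov_iff.1 h
  simp

theorem momentW_mulVec {r : Vec N} {l : ℕ} (a : Fin l → ℂ) (i : Fin l) :
    (momentW n A q r l *ᵥ a) i = moment n A q i (∑ j, a j • ((A ^ (j : ℕ)) *ᵥ r)) := by
  simp only [Matrix.mulVec, dotProduct, momentW, Matrix.of_apply, hdot_leftVec, moment_sum,
    moment_smul, mul_comm]

theorem momentS_mulVec {r : Vec N} {l : ℕ} (a : Fin l → ℂ) (i : Fin l) :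
    (momentS n A q r l *ᵥ a) i = moment n A q i (A *ᵥ ∑ j, a j • ((A ^ (j : ℕ)) *ᵥ r)) := by
  simp only [Matrix.mulVec, dotProduct, momentS, Matrix.of_apply, hdot_leftVec]
  simp only [← Matrix.mulVecLin_apply A, map_sum, map_smul, moment_sum, moment_smul, mul_comm]

/-- A Krylov vector annihilated by all moments vanishes. -/
theorem eq_zero_of_momentW {r v : Vec N} {l : ℕ} (hW : (momentW n A q r l).det ≠ 0)
    (hv : v ∈ krylov A r l) (h : ∀ s < l, moment n A q s v = 0) : v = 0 := by
  obtain ⟨a, rfl⟩ := mem_krylov_iff.1 hv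
  have : a = 0 := Matrix.eq_zero_of_mulVec_eq_zero hW <| by
    ext i
    rw [momentW_mulVec, h i i.2, Pi.zero_apply]
  simp [this]

theorem eq_zero_of_momentS {r v : Vec N} {l : ℕ} (hS : (momentS n A q r l).det ≠ 0)
    (hv : v ∈ krylov A r l) (h : ∀ s < l, moment n A q s (A *ᵥ v) = 0) : v = 0 := by
  obtain ⟨a, rfl⟩ := mem_krylov_iff.1 hv
  have : a = 0 := Matrix.eq_zero_of_mulVec_eq_zero hS <| by
    ext i
    rw [momentS_mulVec, h i i.2, Pi.zero_apply]
  simp [this]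

/-- A residual polynomial of degree at most `l` does not annihilate `r`. -/
theorem ne_zero_of_sub_mem_map_krylov {r v : Vec N} {l : ℕ}
    (hW : (momentW n A q r (l + 1)).det ≠ 0)
    (hv : v - r ∈ (krylov A r l).map A.mulVecLin) : v ≠ 0 := by
  rintro rfl
  obtain ⟨y, hy, hyr⟩ := hv
  obtain ⟨a, rfl⟩ := mem_krylov_iff.1 hy
  -- The constant coefficient of a residual polynomial is 1, so its coefficient vector is a nonzero
  -- candidate for the kernel of `W`.
  have : (Fin.cons 1 a : Fin (l + 1) → ℂ) = 0 := Matrix.eq_zero_of_mulVec_eq_zero hW <| by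
    ext i
    rw [momentW_mulVec, Fin.sum_univ_succ]
    have h : r + ∑ j : Fin l, a j • ((A ^ ((j : ℕ) + 1)) *ᵥ r) = 0 := by
      have h' := hyr
      simp only [map_sum, map_smul, Matrix.mulVecLin_apply, Matrix.mulVec_mulVec, ← pow_succ',
        zero_sub] at h'
      rw [h', add_neg_cancel]
    simp only [Fin.cons_zero, Fin.cons_succ, Fin.val_zero, Fin.val_succ, pow_zero, one_smul,
      Matrix.one_mulVec, h]
    simp [moment, hdot_zero]
  simpa using congrFun this 0

/-- The minimal polynomial expresses the power of degree `ν` by lower ones. This forces the residual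
to vanish at step `ν`; for `ν = 0` it says `r = 0`. -/
theorem krylov_succ_minPolyDegree (A : Matrix (Fin N) (Fin N) ℂ) (r : Vec N) :
    krylov A r (minPolyDegree A r + 1) ≤ krylov A r (minPolyDegree A r) := by
  obtain ⟨p, hp, hd, h0⟩ := minPolyDegree_mem A r
  refine Submodule.span_le.2 ?_
  rintro _ ⟨i, hi, rfl⟩
  rcases Nat.lt_succ_iff_lt_or_eq.1 hi with hi | rfl
  · exact pow_mulVec_mem_krylov r hi
  rw [hp.as_sum, hd] at h0
  simp only [map_add, map_pow, Polynomial.aeval_X, map_sum, map_mul, Polynomial.aeval_C,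
    Matrix.add_mulVec, Matrix.sum_mulVec, ← Algebra.smul_def, Matrix.smul_mulVec] at h0
  rw [eq_neg_of_add_eq_zero_left h0]
  exact neg_mem <| sum_mem fun i hi =>
    Submodule.smul_mem _ _ (pow_mulVec_mem_krylov r (Finset.mem_range.1 hi))

/-! ### The stabilizing polynomial and its effect on moments -/

/-- The stabilizing matrix polynomial `(1 + ρ₁ A) ⋯ (1 + ρ_j A)`. -/
def stab (A : Matrix (Fin N) (Fin N) ℂ) (ρ : ℕ → ℂ) : ℕ → Matrix (Fin N) (Fin N) ℂ
  | 0 => 1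
  | j + 1 => stab A ρ j * (1 + ρ (j + 1) • A)

variable {ρ : ℕ → ℂ}

theorem stab_zero_mulVec (v : Vec N) : stab A ρ 0 *ᵥ v = v := Matrix.one_mulVec v

theorem stab_succ_mulVec (j : ℕ) (v : Vec N) :
    stab A ρ (j + 1) *ᵥ v = stab A ρ j *ᵥ v + ρ (j + 1) • (stab A ρ j *ᵥ (A *ᵥ v)) := by
  rw [stab, ← Matrix.mulVec_mulVec, Matrix.add_mulVec, Matrix.one_mulVec, Matrix.smul_mulVec,
    Matrix.mulVec_add, Matrix.mulVec_smul]

theorem mulVec_stab_mulVec (j : ℕ) (v : Vec N) :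
    A *ᵥ (stab A ρ j *ᵥ v) = stab A ρ j *ᵥ (A *ᵥ v) := by
  induction j generalizing v with
  | zero => simp only [stab_zero_mulVec]
  | succ j ih => simp only [stab_succ_mulVec, Matrix.mulVec_add, Matrix.mulVec_smul, ih]

theorem stab_congr {ρ' : ℕ → ℂ} {j : ℕ} (h : ∀ m < j, ρ (m + 1) = ρ' (m + 1)) :
    stab A ρ j = stab A ρ' j := by
  induction j with
  | zero => rfl
  | succ j ih => rw [stab, stab, ih fun m hm => h m (by omega), h j (by omega)]

theorem stab_mulVec_mem_krylov {r v : Vec N} {l : ℕ} (j : ℕ) (h : v ∈ krylov A r l) :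
    stab A ρ j *ᵥ v ∈ krylov A r (l + j) := by
  induction j generalizing v l with
  | zero => rwa [stab_zero_mulVec]
  | succ j ih =>
    rw [stab_succ_mulVec]
    refine add_mem (krylov_mono r (by omega) (ih h)) (Submodule.smul_mem _ _ ?_)
    have := ih (mulVec_mem_krylov h)
    rwa [add_right_comm] at this

theorem isUnit_stab {j : ℕ} (h : ∀ m < j, IsUnit (1 + ρ (m + 1) • A)) : IsUnit (stab A ρ j) := by
  induction j with
  | zero => exact isUnit_one
  | succ j ih => exact (ih fun m hm => h m (by omega)).mul (h j (by omega))

theorem mulVec_ne_zero_of_isUnit {M : Matrix (Fin N) (Fin N) ℂ} (hM : IsUnit M) {v : Vec N}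
    (hv : v ≠ 0) : M *ᵥ v ≠ 0 := fun h =>
  hv (Matrix.mulVec_injective_of_isUnit hM (by rw [h, Matrix.mulVec_zero]))

theorem isUnit_one_add_smul {a : ℂ} (ha : a ≠ 0) (h : -1 / a ∉ spectrum ℂ A) :
    IsUnit (1 + a • A) := by
  rw [spectrum.notMem_iff] at h
  have h' := (isUnit_iff_ne_zero.2 (neg_ne_zero.2 ha)).map
    (algebraMap ℂ (Matrix (Fin N) (Fin N) ℂ)) |>.mul h
  convert h' using 1
  rw [mul_sub, ← map_mul, ← Algebra.smul_def, neg_smul, sub_neg_eq_add,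
    show -a * (-1 / a) = 1 by field_simp, map_one]

/-- Only the leading term of the stabilizing polynomial contributes if the lower powers do not. -/
theorem hdot_stab_mulVec {p v : Vec N} {j : ℕ} (h : ∀ t < j, hdot p ((A ^ t) *ᵥ v) = 0) :
    hdot p (stab A ρ j *ᵥ v) =
      (∏ m ∈ Finset.range j, ρ (m + 1)) * hdot p ((A ^ j) *ᵥ v) := by
  induction j generalizing v with
  | zero => simp [stab_zero_mulVec]
  | succ j ih =>
    have hA : ∀ t, (A ^ t) *ᵥ (A *ᵥ v) = (A ^ (t + 1)) *ᵥ v := fun t => by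
      rw [Matrix.mulVec_mulVec, pow_succ]
    rw [stab_succ_mulVec, hdot_add, hdot_smul, ih fun t ht => h t (by omega), h j (by omega),
      ih fun t ht => by rw [hA]; exact h _ (by omega), hA, Finset.prod_range_succ]
    ring

/-- Pairing `q_{s % n + 1}` with `A ^ t v` for `t < s / n` is the moment of index `s % n + n t < s`,
which vanishes; only the leading coefficient of the stabilizing polynomial survives. -/
theorem hdot_stab_mulVec_moment (hn : 1 ≤ n) {v : Vec N} {s : ℕ}
    (h : ∀ t < s, moment n A q t v = 0) :
    hdot (q (s % n + 1)) (stab A ρ (s / n) *ᵥ v) =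
      (∏ m ∈ Finset.range (s / n), ρ (m + 1)) * moment n A q s v := by
  refine hdot_stab_mulVec fun t ht => ?_
  have hs := Nat.div_add_mod s n
  have hm : (s % n + n * t) % n = s % n := by simp
  have hd : (s % n + n * t) / n = t := by
    rw [Nat.add_mul_div_left _ _ (by omega), Nat.div_eq_of_lt (Nat.mod_lt _ (by omega)), zero_add]
  have := h (s % n + n * t) (by
    have : n * t + n * 1 ≤ n * (s / n) := by rw [← mul_add]; exact Nat.mul_le_mul_left _ ht
    omega)
  rwa [moment, hm, hd] at this

end MLBiCGStab

/-! ### The invariant, and the first half of an iteration -/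

namespace MLBiCGStab

variable {N : ℕ}

/-- The number `⌈s / n⌉` of stabilizing factors in the residual `r_s`. -/
def stabCount (n s : ℕ) : ℕ := (s + n - 1) / n

theorem stabCount_succ {n : ℕ} (hn : 1 ≤ n) (k : ℕ) : stabCount n (k + 1) = k / n + 1 := by
  rw [stabCount, show k + 1 + n - 1 = k + n by omega, Nat.add_div_right _ (by omega)]

theorem stabCount_mono {n k l : ℕ} (h : k ≤ l) : stabCount n k ≤ stabCount n l :=
  Nat.div_le_div_right (by omega)

theorem stabCount_of_mod_eq {n s : ℕ} (hn : 1 ≤ n) (h : s % n = 0) : stabCount n s = s / n := by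
  obtain ⟨t, rfl⟩ := Nat.dvd_of_mod_eq_zero h
  rw [stabCount, Nat.mul_div_cancel_left _ (by omega), Nat.add_sub_assoc hn,
    Nat.mul_add_div (by omega), Nat.div_eq_of_lt (by omega), add_zero]

theorem succ_div_of_mod_ne {n k : ℕ} (h : (k + 1) % n ≠ 0) : (k + 1) / n = k / n := by
  rw [Nat.succ_div, if_neg fun h' => h (Nat.mod_eq_zero_of_dvd h'), add_zero]

theorem stabCount_of_mod_ne {n s : ℕ} (hn : 1 ≤ n) (h : s % n ≠ 0) :
    stabCount n s = s / n + 1 := by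
  obtain _ | k := s
  · simp at h
  · rw [stabCount_succ hn, succ_div_of_mod_ne h]

theorem rIdx_succ_lt_iff {n : ℕ} (hn : 1 ≤ n) (k : ℕ) : rIdx n (k + 1) < n ↔ (k + 1) % n ≠ 0 := by
  rw [rIdx_succ, Nat.add_mod]
  have := Nat.mod_lt k (show n > 0 by omega)
  rcases Nat.lt_or_ge 1 n with h | h
  · rw [Nat.mod_eq_of_lt h]
    rcases Nat.lt_or_ge (k % n + 1) n with h' | h'
    · rw [Nat.mod_eq_of_lt h']; omega
    · rw [show k % n + 1 = n by omega, Nat.mod_self]; omega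
  · obtain rfl : n = 1 := by omega
    simp [Nat.mod_one]

/-- The vector `R` is the biorthogonal residual behind the `s`-th entries of the state. -/
structure IsResidual (n : ℕ) (A : Matrix (Fin N) (Fin N) ℂ) (b x₀ : Vec N) (q : ℕ → Vec N)
    (st : State N) (s : ℕ) (R : Vec N) : Prop where
  mem : R - (b - A *ᵥ x₀) ∈ (krylov A (b - A *ᵥ x₀) s).map A.mulVecLin
  orth : ∀ t < s, moment n A q t R = 0
  r_eq : st.r s = stab A st.ρ (stabCount n s) *ᵥ R
  u_eq : s % n ≠ 0 → st.u s = stab A st.ρ (s / n) *ᵥ R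
  x_res : b - A *ᵥ st.x s = st.r s
  x_mem : st.x s - x₀ ∈ krylov A (b - A *ᵥ x₀) (s + stabCount n s)
  ρ_ne : ∀ m < stabCount n s, st.ρ (m + 1) ≠ 0
  ρ_unit : ∀ m < stabCount n s, IsUnit (1 + st.ρ (m + 1) • A)

/-- The vector `G` is the biconjugate direction behind the `s`-th entries of the state. -/
structure IsDirection (n : ℕ) (A : Matrix (Fin N) (Fin N) ℂ) (b x₀ : Vec N) (q : ℕ → Vec N)
    (st : State N) (s : ℕ) (R G : Vec N) : Prop where
  mem : G - R ∈ krylov A (b - A *ᵥ x₀) s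
  orth : ∀ t < s, moment n A q t (A *ᵥ G) = 0
  g_eq : st.g s = stab A st.ρ (stabCount n s) *ᵥ G
  w_eq : st.w s = stab A st.ρ (stabCount n s) *ᵥ (A *ᵥ G)
  d_eq : s % n ≠ 0 → st.d s = st.ρ (s / n + 1) • (stab A st.ρ (s / n) *ᵥ (A *ᵥ G))
  c_eq : st.c s = if s % n = 0 then hdot (q 1) (st.w s) else hdot (q (s % n + 1)) (st.d s)

/-- Two states with the same entries up to the index `k`. -/
structure AgreeTo (n k : ℕ) (st st' : State N) : Prop where
  x : ∀ s ≤ k, st'.x s = st.x s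
  r : ∀ s ≤ k, st'.r s = st.r s
  u : ∀ s ≤ k, st'.u s = st.u s
  g : ∀ s ≤ k, st'.g s = st.g s
  w : ∀ s ≤ k, st'.w s = st.w s
  d : ∀ s ≤ k, st'.d s = st.d s
  c : ∀ s ≤ k, st'.c s = st.c s
  -- The bound leaves room for a new `ρ`: when `n ∣ k`, the next iteration writes index `k / n + 1`,
  -- just beyond it.
  ρ : ∀ m < stabCount n k, st'.ρ (m + 1) = st.ρ (m + 1)

variable {n : ℕ} {A : Matrix (Fin N) (Fin N) ℂ} {b x₀ : Vec N} {q : ℕ → Vec N}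
  {st st' : State N} {R G : Vec N} {k s : ℕ}

theorem IsResidual.congr (h : IsResidual n A b x₀ q st s R) (hx : st'.x s = st.x s)
    (hr : st'.r s = st.r s) (hu : st'.u s = st.u s)
    (hρ : ∀ m < stabCount n s, st'.ρ (m + 1) = st.ρ (m + 1)) :
    IsResidual n A b x₀ q st' s R where
  mem := h.mem
  orth := h.orth
  r_eq := by rw [hr, h.r_eq, stab_congr hρ]
  u_eq hs := by
    rw [hu, h.u_eq hs, stab_congr fun m hm => (hρ m ?_).symm]
    exact hm.trans_le (Nat.div_le_div_right (by
      have : n ≠ 0 := by rintro rfl; simp [stabCount] at *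
      omega))
  x_res := by rw [hx, hr, h.x_res]
  x_mem := by rw [hx]; exact h.x_mem
  ρ_ne m hm := by rw [hρ m hm]; exact h.ρ_ne m hm
  ρ_unit m hm := by rw [hρ m hm]; exact h.ρ_unit m hm

theorem IsResidual.agree (h : IsResidual n A b x₀ q st s R) (ha : AgreeTo n k st st')
    (hs : s ≤ k) : IsResidual n A b x₀ q st' s R :=
  h.congr (ha.x s hs) (ha.r s hs) (ha.u s hs) fun m hm => ha.ρ m (hm.trans_le (stabCount_mono hs))

theorem IsDirection.agree (hn : 1 ≤ n) (h : IsDirection n A b x₀ q st s R G)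
    (ha : AgreeTo n k st st') (hs : s ≤ k) : IsDirection n A b x₀ q st' s R G where
  mem := h.mem
  orth := h.orth
  g_eq := by
    rw [ha.g s hs, h.g_eq, stab_congr fun m hm => ha.ρ m (hm.trans_le (stabCount_mono hs))]
  w_eq := by
    rw [ha.w s hs, h.w_eq, stab_congr fun m hm => ha.ρ m (hm.trans_le (stabCount_mono hs))]
  d_eq hs' := by
    have hc := stabCount_of_mod_ne hn hs' ▸ stabCount_mono (n := n) hs
    rw [ha.d s hs, h.d_eq hs', ha.ρ _ (by omega), stab_congr fun m hm => ha.ρ m (by omega)]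
  c_eq := by rw [ha.c s hs, ha.w s hs, ha.d s hs, h.c_eq]

theorem mem_krylov_of_sub_mem_map {r v : Vec N} {l : ℕ}
    (h : v - r ∈ (krylov A r l).map A.mulVecLin) : v ∈ krylov A r (l + 1) := by
  obtain ⟨y, hy, hyr⟩ := h
  rw [← sub_add_cancel v r, ← hyr]
  exact add_mem (mulVec_mem_krylov hy) (self_mem_krylov _ (by omega))

theorem IsResidual.mem_krylov (h : IsResidual n A b x₀ q st s R) :
    R ∈ krylov A (b - A *ᵥ x₀) (s + 1) :=
  mem_krylov_of_sub_mem_map h.mem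

theorem IsDirection.mem_krylov (h : IsDirection n A b x₀ q st s R G)
    (hR : IsResidual n A b x₀ q st s R) : G ∈ krylov A (b - A *ᵥ x₀) (s + 1) := by
  rw [← sub_add_cancel G R]
  exact add_mem (krylov_mono _ (by omega) h.mem) hR.mem_krylov

theorem residual_succ_mem (hR : IsResidual n A b x₀ q st k R)
    (hG : IsDirection n A b x₀ q st k R G) (a : ℂ) :
    R - a • (A *ᵥ G) - (b - A *ᵥ x₀) ∈ (krylov A (b - A *ᵥ x₀) (k + 1)).map A.mulVecLin := by
  rw [sub_right_comm]
  refine sub_mem (Submodule.map_mono (krylov_mono _ (by omega)) hR.mem)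
    (Submodule.smul_mem _ _ ⟨G, hG.mem_krylov hR, rfl⟩)

theorem prod_ρ_ne (hρ : ∀ m < stabCount n s, st.ρ (m + 1) ≠ 0) {j : ℕ} (hj : j ≤ stabCount n s) :
    ∏ m ∈ Finset.range j, st.ρ (m + 1) ≠ 0 :=
  Finset.prod_ne_zero_iff.2 fun m hm => hρ m ((Finset.mem_range.1 hm).trans_le hj)

theorem div_le_stabCount (hn : 1 ≤ n) (s : ℕ) : s / n ≤ stabCount n s :=
  Nat.div_le_div_right (by omega)

/-- The older relations hold for both `R` and `A G`; the scalar test supplies the one of index `k`,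
after division by the nonzero product of the `ρ`'s. -/
theorem residual_succ_orth (hn : 1 ≤ n) (hR : IsResidual n A b x₀ q st k R)
    (hG : IsDirection n A b x₀ q st k R G) (a : ℂ)
    (h : hdot (q (k % n + 1)) (stab A st.ρ (k / n) *ᵥ (R - a • (A *ᵥ G))) = 0) :
    ∀ t < k + 1, moment n A q t (R - a • (A *ᵥ G)) = 0 := by
  have h' : ∀ t < k, moment n A q t (R - a • (A *ᵥ G)) = 0 := fun t ht => by
    rw [moment_sub, moment_smul, hR.orth t ht, hG.orth t ht, mul_zero, sub_zero]
  intro t ht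
  rcases Nat.lt_succ_iff_lt_or_eq.1 ht with ht | rfl
  · exact h' t ht
  · rw [hdot_stab_mulVec_moment hn h'] at h
    exact (mul_eq_zero.1 h).resolve_left (prod_ρ_ne hR.ρ_ne (div_le_stabCount hn t))

theorem safeDiv_eq_some {a c : ℂ} (h : c ≠ 0) : safeDiv a c = some (a / c) := if_neg h

theorem agreeTo_residual {x r : Vec N} {u' : ℕ → Vec N} {ρ : ℕ → ℂ} {P : Prop}
    (hu : ∀ s ≤ k, u' s = st.u s) (hρ : ∀ m < stabCount n k, ρ (m + 1) = st.ρ (m + 1)) :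
    AgreeTo n k st { st with
      x := Function.update st.x (k + 1) x
      u := u'
      r := Function.update st.r (k + 1) r
      ρ := ρ
      stopped := P } where
  x s hs := Function.update_of_ne (by omega) _ _
  r s hs := Function.update_of_ne (by omega) _ _
  u := hu
  g s hs := rfl
  w s hs := rfl
  d s hs := rfl
  c s hs := rfl
  ρ := hρ

/-- The last iteration when `n ∣ k`: the new hidden residual is zero, so `u = 0` and the stop
precedes any use of a new `ρ`. -/
theorem residualHalf_terminal (hn : 1 ≤ n) (hk : k % n = 0) (hR : IsResidual n A b x₀ q st k R)
    (hG : IsDirection n A b x₀ q st k R G) (hc : st.c k ≠ 0)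
    (hz : ∀ R', R' - (b - A *ᵥ x₀) ∈ (krylov A (b - A *ᵥ x₀) (k + 1)).map A.mulVecLin →
      (∀ t < k + 1, moment n A q t R' = 0) → R' = 0) :
    ∃ st', residualHalf n A q (k + 1) st = some st' ∧ st'.stopped ∧ AgreeTo n k st st' ∧
      st'.r (k + 1) = 0 ∧ A *ᵥ st'.x (k + 1) = b := by
  set a := hdot (q 1) (st.r k) / st.c k with ha
  have hcl := stabCount_of_mod_eq hn hk
  have hu : st.r k - a • st.w k = stab A st.ρ (k / n) *ᵥ (R - a • (A *ᵥ G)) := by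
    rw [hR.r_eq, hG.w_eq, hcl, Matrix.mulVec_sub, Matrix.mulVec_smul]
  have hu0 : st.r k - a • st.w k = 0 := by
    rw [hu, hz _ (residual_succ_mem hR hG a) (residual_succ_orth hn hR hG a ?_),
      Matrix.mulVec_zero]
    rw [← hu, hdot_sub, hdot_smul, ha, hk, div_mul_eq_mul_div]
    rw [hG.c_eq, if_pos hk] at hc ⊢
    rw [mul_div_cancel_right₀ _ hc, sub_self]
  refine ⟨_, ?_, ?_, agreeTo_residual (st := st) (P := True) (u' := Function.update st.u (k + 1) 0)
    (x := st.x k + a • st.g k) (r := 0) (ρ := st.ρ)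
    (fun s hs => Function.update_of_ne (by omega) _ _) fun _ _ => rfl, ?_, ?_⟩
  · have h1 : rIdx n (k + 1) = 1 := by rw [rIdx_succ, hk]
    simp only [residualHalf, h1, if_true, Nat.add_sub_cancel, safeDiv_eq_some hc, ← ha, hu0,
      Option.bind_eq_bind, Option.bind_some]
  · trivial
  · simp
  · have hAg : A *ᵥ st.g k = st.w k := by rw [hG.g_eq, hG.w_eq, mulVec_stab_mulVec]
    have := hR.x_res
    simp only [Function.update_self, Matrix.mulVec_add, Matrix.mulVec_smul, hAg]
    rw [sub_eq_zero, ← this, sub_eq_iff_eq_add] at hu0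
    rw [hu0]; abel

/-- The case that introduces a new stabilizing factor. Hypothesis `hz` gives `A u ≠ 0`, so the
divisor of `ρ` is nonzero and the early stop is not taken; `hρ` is applied only once the computed
state is known. -/
theorem residualHalf_first (hn : 1 ≤ n) (hk : k % n = 0) (hR : IsResidual n A b x₀ q st k R)
    (hG : IsDirection n A b x₀ q st k R G) (hc : st.c k ≠ 0)
    (hz : ∀ R', R' - (b - A *ᵥ x₀) ∈ (krylov A (b - A *ᵥ x₀) (k + 1)).map A.mulVecLin →
      (∀ t < k + 1, moment n A q t R' = 0) → A *ᵥ R' ≠ 0) (hst : ¬ st.stopped)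
    (hρ : ∀ st', residualHalf n A q (k + 1) st = some st' → ¬ st'.stopped →
      st'.ρ (k / n + 1) ≠ 0 ∧ IsUnit (1 + st'.ρ (k / n + 1) • A)) :
    ∃ st' R', residualHalf n A q (k + 1) st = some st' ∧ ¬ st'.stopped ∧ AgreeTo n k st st' ∧
      IsResidual n A b x₀ q st' (k + 1) R' := by
  set a := hdot (q 1) (st.r k) / st.c k with ha
  have hcl := stabCount_of_mod_eq hn hk
  have hcl' := stabCount_succ hn k
  set R' := R - a • (A *ᵥ G) with hR'
  have hu : st.r k - a • st.w k = stab A st.ρ (k / n) *ᵥ R' := by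
    rw [hR.r_eq, hG.w_eq, hcl, hR', Matrix.mulVec_sub, Matrix.mulVec_smul]
  have hmem := residual_succ_mem hR hG a
  have horth := residual_succ_orth hn hR hG a (by
    rw [← hR', ← hu, hdot_sub, hdot_smul, ha, hk, div_mul_eq_mul_div]
    rw [hG.c_eq, if_pos hk] at hc ⊢
    rw [mul_div_cancel_right₀ _ hc, sub_self])
  have hun : IsUnit (stab A st.ρ (k / n)) := isUnit_stab fun m hm => hR.ρ_unit m (by omega)
  set u := st.r k - a • st.w k with hu_def
  have hAu : A *ᵥ u ≠ 0 := by
    rw [hu, mulVec_stab_mulVec]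
    exact mulVec_ne_zero_of_isUnit hun (hz _ hmem horth)
  have hu0 : u ≠ 0 := fun h => hAu (by rw [h, Matrix.mulVec_zero])
  have hnorm : (((‖WithLp.toLp 2 (A *ᵥ u)‖ ^ 2 : ℝ)) : ℂ) ≠ 0 := by
    rw [Complex.ofReal_ne_zero]
    refine pow_ne_zero _ (norm_ne_zero_iff.2 fun h => hAu ?_)
    simpa using congrArg WithLp.ofLp h
  set ρk := -(hdot (A *ᵥ u) u) / (((‖WithLp.toLp 2 (A *ᵥ u)‖ ^ 2 : ℝ)) : ℂ) with hρk
  have hrun : residualHalf n A q (k + 1) st = some { st with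
        x := Function.update st.x (k + 1) (st.x k + a • st.g k - ρk • u)
        u := Function.update st.u (k + 1) u
        r := Function.update st.r (k + 1) (ρk • (A *ᵥ u) + u)
        ρ := Function.update st.ρ (k / n + 1) ρk } := by
    have h1 : rIdx n (k + 1) = 1 := by rw [rIdx_succ, hk]
    simp only [residualHalf, h1, if_true, Nat.add_sub_cancel, safeDiv_eq_some hc, ← ha,
      Option.bind_eq_bind, Option.bind_some, ← hu_def, if_neg hu0, safeDiv_eq_some hnorm,
      ← hρk, gIdx_succ]
  have hρ' := hρ _ hrun hst
  simp only [Function.update_self] at hρ'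
  have hlt : ∀ m < k / n, Function.update st.ρ (k / n + 1) ρk (m + 1) = st.ρ (m + 1) :=
    fun m hm => Function.update_of_ne (by omega) _ _
  have hAg : A *ᵥ st.g k = st.w k := by rw [hG.g_eq, hG.w_eq, mulVec_stab_mulVec]
  have hR1 : R' ∈ krylov A (b - A *ᵥ x₀) (k + 1 + 1) :=
    sub_mem (krylov_mono _ (by omega) hR.mem_krylov)
      (Submodule.smul_mem _ _ (mulVec_mem_krylov (hG.mem_krylov hR)))
  refine ⟨_, R', hrun, hst, agreeTo_residual
    (fun s hs => Function.update_of_ne (by omega) _ _) (by rw [hcl]; exact hlt), ?_⟩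
  constructor
  · exact hmem
  · exact horth
  · simp only [Function.update_self, hcl', stab_succ_mulVec]
    rw [stab_congr hlt, hu, mulVec_stab_mulVec, add_comm]
  · intro hk'
    simp only [Function.update_self]
    rw [succ_div_of_mod_ne hk', stab_congr hlt, hu]
  · simp only [Function.update_self, Matrix.mulVec_add, Matrix.mulVec_sub, Matrix.mulVec_smul, hAg]
    rw [hu_def, ← hR.x_res]; abel
  · simp only [Function.update_self]
    rw [show st.x k + a • st.g k - ρk • u - x₀ = (st.x k - x₀) + a • st.g k - ρk • u by abel]
    refine sub_mem (add_mem (krylov_mono _ ?_ hR.x_mem) (Submodule.smul_mem _ _ ?_))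
      (Submodule.smul_mem _ _ ?_)
    · omega
    · rw [hG.g_eq]
      exact krylov_mono _ (by omega) (stab_mulVec_mem_krylov _ (hG.mem_krylov hR))
    · rw [hu]
      exact krylov_mono _ (by omega) (stab_mulVec_mem_krylov _ hR1)
  · intro m hm
    rcases Nat.lt_or_ge m (k / n) with h | h
    · simp only [hlt m h]; exact hR.ρ_ne m (by omega)
    · obtain rfl : m = k / n := by omega
      simpa only [Function.update_self] using hρ'.1
  · intro m hm
    rcases Nat.lt_or_ge m (k / n) with h | h
    · simp only [hlt m h]; exact hR.ρ_unit m (by omega)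
    · obtain rfl : m = k / n := by omega
      simpa only [Function.update_self] using hρ'.2

theorem residualHalf_next (hn : 1 ≤ n) (hk : k % n ≠ 0) (hR : IsResidual n A b x₀ q st k R)
    (hG : IsDirection n A b x₀ q st k R G) (hc : st.c k ≠ 0) (hst : ¬ st.stopped) :
    ∃ st' R', residualHalf n A q (k + 1) st = some st' ∧ ¬ st'.stopped ∧ AgreeTo n k st st' ∧
      IsResidual n A b x₀ q st' (k + 1) R' := by
  set a := hdot (q (k % n + 1)) (st.u k) / st.c k with ha
  have hcl := stabCount_of_mod_ne hn hk
  have hcl' := stabCount_succ hn k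
  set ρk := st.ρ (k / n + 1) with hρk
  -- Since `d_k` carries a factor `ρ`, a step `a` along it is a step `ρ a` along the hidden vector
  -- `A G`.
  set R' := R - (ρk * a) • (A *ᵥ G) with hR'
  have hu : st.u k - a • st.d k = stab A st.ρ (k / n) *ᵥ R' := by
    rw [hR.u_eq hk, hG.d_eq hk, hR', Matrix.mulVec_sub, Matrix.mulVec_smul]
    module
  have hmem := residual_succ_mem hR hG (ρk * a)
  have horth := residual_succ_orth hn hR hG (ρk * a) (by
    rw [← hR', ← hu, hdot_sub, hdot_smul, ha, div_mul_eq_mul_div]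
    rw [hG.c_eq, if_neg hk] at hc ⊢
    rw [mul_div_cancel_right₀ _ hc, sub_self])
  have hrun : residualHalf n A q (k + 1) st = some { st with
      u := if (k + 1) % n ≠ 0 then Function.update st.u (k + 1) (st.u k - a • st.d k) else st.u
      x := Function.update st.x (k + 1) (st.x k + (ρk * a) • st.g k)
      r := Function.update st.r (k + 1) (st.r k - (ρk * a) • st.w k) } := by
    have h1 : rIdx n (k + 1) ≠ 1 := by rw [rIdx_succ]; omega
    -- The algorithm reads `ρ` with the previous iteration's index; as `n ∤ k`, both iterations lie
    -- in the same block.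
    have h2 : gIdx n k = k / n := by
      obtain _ | k := k
      · simp at hk
      · rw [gIdx_succ, succ_div_of_mod_ne hk]
    rw [residualHalf, if_neg h1]
    simp only [rIdx_succ_lt_iff hn]
    simp only [Nat.add_sub_cancel, rIdx_succ, safeDiv_eq_some hc, ← ha, Option.bind_eq_bind,
      Option.bind_some, h2, ← hρk]
  have hAg : A *ᵥ st.g k = st.w k := by rw [hG.g_eq, hG.w_eq, mulVec_stab_mulVec]
  refine ⟨_, R', hrun, hst, agreeTo_residual (fun s hs => ?_) (fun _ _ => rfl), ?_⟩
  · split_ifs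
    · exact Function.update_of_ne (by omega) _ _
    · rfl
  constructor
  · exact hmem
  · exact horth
  · simp only [Function.update_self, hcl', ← hcl]
    rw [hR.r_eq, hG.w_eq, hR', Matrix.mulVec_sub, Matrix.mulVec_smul]
  · intro hk'
    simp only [if_pos hk', Function.update_self]
    rw [succ_div_of_mod_ne hk', hu]
  · simp only [Function.update_self, Matrix.mulVec_add, Matrix.mulVec_smul, hAg]
    rw [← hR.x_res]; abel
  · simp only [Function.update_self, hcl', ← hcl]
    rw [show st.x k + (ρk * a) • st.g k - x₀ = (st.x k - x₀) + (ρk * a) • st.g k by abel]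
    refine add_mem (krylov_mono _ (by omega) hR.x_mem) (Submodule.smul_mem _ _ ?_)
    rw [hG.g_eq]
    exact krylov_mono _ (by omega) (stab_mulVec_mem_krylov _ (hG.mem_krylov hR))
  · rw [hcl', ← hcl]; exact hR.ρ_ne
  · rw [hcl', ← hcl]; exact hR.ρ_unit

end MLBiCGStab

/-! ### The second half of an iteration: Gram–Schmidt on hidden directions -/

namespace MLBiCGStab

variable {N : ℕ}

/-- A loop whose body preserves an invariant does not fail and ends with the invariant. -/
theorem exists_forLoop {α : Type} {body : ℕ → α → Option α} (P : ℕ → α → Prop) {a e : ℕ}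
    (hae : a ≤ e)
    (h : ∀ s acc, a ≤ s → s < e → P s acc → ∃ acc', body s acc = some acc' ∧ P (s + 1) acc')
    {init : α} (h0 : P a init) : ∃ acc, forLoop a e body init = some acc ∧ P e acc := by
  obtain ⟨m, rfl⟩ := Nat.exists_eq_add_of_le hae
  rw [forLoop, Nat.add_sub_cancel_left]
  induction m generalizing a init with
  | zero => exact ⟨init, rfl, h0⟩
  | succ m ih =>
    obtain ⟨acc, hacc, hP⟩ := h a init le_rfl (by omega) h0
    obtain ⟨acc', hacc', hP'⟩ := ih (a := a + 1) (init := acc) hP (by omega)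
      fun s acc h1 h2 => h s acc (by omega) (by omega)
    refine ⟨acc', ?_, by rwa [add_right_comm, add_assoc] at hP'⟩
    rw [List.range'_succ, List.foldlM_cons, hacc]
    exact hacc'

variable {n : ℕ} {A : Matrix (Fin N) (Fin N) ℂ} {b x₀ : Vec N} {q : ℕ → Vec N}
  {st : State N} {k : ℕ}

/-- One orthogonalization step: if the auxiliary vector is orthogonal to `q_{m % n + 1}`, then the
image of the direction is orthogonal to the next left vector. -/
theorem orth_succ_of_hdot_eq_zero {R Y : Vec N} {ρ : ℕ → ℂ} {m : ℕ} (hn : 1 ≤ n)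
    (hR : ∀ t < k, moment n A q t R = 0) (hm : m < k)
    (hY : ∀ t < m, moment n A q t (A *ᵥ (R + Y)) = 0) (hρ : ∀ i ≤ m / n, ρ (i + 1) ≠ 0)
    (h : hdot (q (m % n + 1)) (stab A ρ (m / n + 1) *ᵥ R +
      ρ (m / n + 1) • (stab A ρ (m / n) *ᵥ (A *ᵥ Y))) = 0) :
    ∀ t < m + 1, moment n A q t (A *ᵥ (R + Y)) = 0 := by
  intro t ht
  rcases Nat.lt_succ_iff_lt_or_eq.1 ht with ht | rfl
  · exact hY t ht
  -- Splitting off `stab A ρ (t / n) *ᵥ R`, which the test vector annihilates because `t < k`,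
  -- leaves a pure test of `A (R + Y)`.
  have h1 : stab A ρ (t / n + 1) *ᵥ R + ρ (t / n + 1) • (stab A ρ (t / n) *ᵥ (A *ᵥ Y)) =
      stab A ρ (t / n) *ᵥ R + ρ (t / n + 1) • (stab A ρ (t / n) *ᵥ (A *ᵥ (R + Y))) := by
    simp only [stab_succ_mulVec, Matrix.mulVec_add]
    module
  rw [h1, hdot_add, hdot_smul, hdot_stab_mulVec_moment hn fun s hs => hR s (by omega), hR t hm,
    mul_zero, zero_add, hdot_stab_mulVec_moment hn hY] at h
  have hp : ∏ i ∈ Finset.range (t / n), ρ (i + 1) ≠ 0 :=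
    Finset.prod_ne_zero_iff.2 fun i hi => hρ i (Finset.mem_range.1 hi).le
  simpa [hρ _ le_rfl, hp] using h

theorem orth_add_smul {R Y G : Vec N} {m : ℕ} (β : ℂ)
    (hY : ∀ t < m, moment n A q t (A *ᵥ (R + Y)) = 0)
    (hG : ∀ t < m, moment n A q t (A *ᵥ G) = 0) :
    ∀ t < m, moment n A q t (A *ᵥ (R + (Y + β • G))) = 0 := by
  intro t ht
  rw [← add_assoc, Matrix.mulVec_add, Matrix.mulVec_smul, moment_add, moment_smul, hY t ht,
    hG t ht, mul_zero, add_zero]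

theorem div_eq_of_mul_lt {j s : ℕ} (h1 : j * n < s) (h2 : s < j * n + n) :
    s / n = j ∧ s % n ≠ 0 := by
  have h3 : s / n = j := Nat.div_eq_of_lt_le h1.le (by rw [Nat.succ_mul]; exact h2)
  refine ⟨h3, fun h4 => ?_⟩
  have h5 := Nat.div_add_mod s n
  rw [h3, h4, mul_comm] at h5
  omega

/-- A Gram–Schmidt step against the direction with index `s` not divisible by `n`. -/
theorem orth_step {R Y Z Rs G : Vec N} {s : ℕ} (hn : 1 ≤ n)
    (hR : ∀ t < k, moment n A q t R = 0) (hs : s < k) (hsn : s % n ≠ 0)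
    (hRs : IsResidual n A b x₀ q st s Rs) (hG : IsDirection n A b x₀ q st s Rs G)
    (hc : st.c s ≠ 0) (hY : ∀ t < s, moment n A q t (A *ᵥ (R + Y)) = 0)
    (hZ : Z = stab A st.ρ (s / n + 1) *ᵥ R +
      st.ρ (s / n + 1) • (stab A st.ρ (s / n) *ᵥ (A *ᵥ Y))) :
    ∀ β, β = -(hdot (q (s % n + 1)) Z) / st.c s →
      Z + β • st.d s = stab A st.ρ (s / n + 1) *ᵥ R +
        st.ρ (s / n + 1) • (stab A st.ρ (s / n) *ᵥ (A *ᵥ (Y + β • G))) ∧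
      ∀ t < s + 1, moment n A q t (A *ᵥ (R + (Y + β • G))) = 0 := by
  intro β hβ
  have h1 : Z + β • st.d s = stab A st.ρ (s / n + 1) *ᵥ R +
        st.ρ (s / n + 1) • (stab A st.ρ (s / n) *ᵥ (A *ᵥ (Y + β • G))) := by
    rw [hZ, hG.d_eq hsn]
    simp only [Matrix.mulVec_add, Matrix.mulVec_smul]
    module
  refine ⟨h1, orth_succ_of_hdot_eq_zero hn hR hs (orth_add_smul β hY hG.orth)
    (fun i hi => hRs.ρ_ne i (by rw [stabCount_of_mod_ne hn hsn]; omega)) ?_⟩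
  rw [← h1, hdot_add, hdot_smul, hβ]
  rw [hG.c_eq, if_neg hsn] at hc ⊢
  rw [div_mul_cancel₀ _ hc, add_neg_cancel]

/-- The new direction is `R + Y`, with `Y` a combination of the directions of index `k + 1 - n, …,
k`; the older relations come from `moment_mulVec`. The indices below `j n`, equal to `j n` and above
`j n` are treated separately since their entries carry different stabilizing factors. -/
theorem directionHalf_eq_some (hn : 1 ≤ n) {R : Vec N} {Rs Gs : ℕ → Vec N}
    (hR : IsResidual n A b x₀ q st (k + 1) R)
    (hRs : ∀ s ≤ k, IsResidual n A b x₀ q st s (Rs s))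
    (hGs : ∀ s ≤ k, IsDirection n A b x₀ q st s (Rs s) (Gs s))
    (hc : ∀ s ≤ k, st.c s ≠ 0) :
    ∃ st' G, directionHalf n A q (k + 1) st = some st' ∧
      (st'.stopped ↔ st'.r (k + 1) = 0) ∧ AgreeTo n k st st' ∧
      IsResidual n A b x₀ q st' (k + 1) R ∧ IsDirection n A b x₀ q st' (k + 1) R G := by
  set j := k / n with hj
  have hkj := Nat.div_add_mod k n
  have hkn := Nat.mod_lt k (show n > 0 by omega)
  rw [← hj, mul_comm] at hkj
  have hcl := stabCount_succ hn k
  rw [← hj] at hcl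
  set ρk := st.ρ (j + 1) with hρk
  have hρ0 : ρk ≠ 0 := hR.ρ_ne j (by omega)
  have hGK : ∀ s ≤ k, Gs s ∈ krylov A (b - A *ᵥ x₀) (k + 1) := fun s hs =>
    krylov_mono _ (by omega) ((hGs s hs).mem_krylov (hRs s hs))
  have hjn : j * n % n = 0 := Nat.mul_mod_left _ _
  have hjn' : j * n / n = j := Nat.mul_div_cancel _ (by omega)
  have hjcl : stabCount n (j * n) = j := by rw [stabCount_of_mod_eq hn hjn, hjn']
  have hgj : st.g (j * n) = stab A st.ρ j *ᵥ Gs (j * n) := by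
    rw [(hGs _ (by omega)).g_eq, hjcl]
  have hwj : st.w (j * n) = stab A st.ρ j *ᵥ (A *ᵥ Gs (j * n)) := by
    rw [(hGs _ (by omega)).w_eq, hjcl]
  -- orthogonalization against the direction with index `j n`
  have mid : ∀ Y z : Vec N, Y ∈ krylov A (b - A *ᵥ x₀) (k + 1) →
      (∀ t < j * n, moment n A q t (A *ᵥ (R + Y)) = 0) →
      z = stab A st.ρ (j + 1) *ᵥ R + ρk • (stab A st.ρ j *ᵥ (A *ᵥ Y)) →
      ∀ β, β = -(hdot (q 1) z) / st.c (j * n) →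
      ∃ Y' ∈ krylov A (b - A *ᵥ x₀) (k + 1),
        (∀ t < j * n + 1, moment n A q t (A *ᵥ (R + Y')) = 0) ∧
        z + β • st.w (j * n) = stab A st.ρ (j + 1) *ᵥ R + ρk • (stab A st.ρ j *ᵥ (A *ᵥ Y')) ∧
        stab A st.ρ j *ᵥ Y + (z + β • st.w (j * n)) + (β / ρk) • st.g (j * n) =
          stab A st.ρ (j + 1) *ᵥ (R + Y') := by
    intro Y z hYK hY hz β hβ
    -- Unlike `d_s`, the vector `w_{jn}` has no factor `ρ`, so the hidden coefficient is `β / ρ`.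
    have h1 : z + β • st.w (j * n) = stab A st.ρ (j + 1) *ᵥ R +
        ρk • (stab A st.ρ j *ᵥ (A *ᵥ (Y + (β / ρk) • Gs (j * n)))) := by
      rw [hz, hwj]
      simp only [Matrix.mulVec_add, Matrix.mulVec_smul, smul_add, smul_smul,
        mul_div_cancel₀ _ hρ0, add_assoc]
    refine ⟨Y + (β / ρk) • Gs (j * n), add_mem hYK (Submodule.smul_mem _ _ (hGK _ (by omega))),
      ?_, h1, ?_⟩
    · refine orth_succ_of_hdot_eq_zero (ρ := st.ρ) hn hR.orth (by omega)
        (orth_add_smul _ hY (hGs _ (by omega)).orth) (fun i hi => hR.ρ_ne i (by omega)) ?_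
      rw [hjn, hjn', ← hρk, ← h1, hdot_add, hdot_smul, hβ]
      have hc' := hc (j * n) (by omega)
      rw [(hGs _ (by omega)).c_eq, if_pos hjn] at hc' ⊢
      rw [div_mul_cancel₀ _ hc', add_neg_cancel]
    · rw [h1, hgj]
      simp only [stab_succ_mulVec, Matrix.mulVec_add, Matrix.mulVec_smul, ← hρk]
      module
  -- orthogonalization against the directions with indices above `j n`
  have tail : ∀ (Y : Vec N) (acc : Vec N × Vec N), Y ∈ krylov A (b - A *ᵥ x₀) (k + 1) →
      (∀ t < j * n + 1, moment n A q t (A *ᵥ (R + Y)) = 0) →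
      acc.1 = stab A st.ρ (j + 1) *ᵥ (R + Y) →
      acc.2 = stab A st.ρ (j + 1) *ᵥ R + ρk • (stab A st.ρ j *ᵥ (A *ᵥ Y)) →
      ∃ acc', forLoop (j * n + 1) (k + 1)
        (fun s (acc : Vec N × Vec N) =>
          (safeDiv (-(hdot (q (s % n + 1)) acc.2)) (st.c s)).bind fun β =>
          some (acc.1 + β • st.g s, acc.2 + β • st.d s)) acc = some acc' ∧
        ∃ Y' ∈ krylov A (b - A *ᵥ x₀) (k + 1),
          (∀ t < k + 1, moment n A q t (A *ᵥ (R + Y')) = 0) ∧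
          acc'.1 = stab A st.ρ (j + 1) *ᵥ (R + Y') ∧
          acc'.2 = stab A st.ρ (j + 1) *ᵥ R + ρk • (stab A st.ρ j *ᵥ (A *ᵥ Y')) := by
    intro Y acc hYK hY h1 h2
    refine exists_forLoop (fun m (acc : Vec N × Vec N) => ∃ Y' ∈ krylov A (b - A *ᵥ x₀) (k + 1),
          (∀ t < m, moment n A q t (A *ᵥ (R + Y')) = 0) ∧
          acc.1 = stab A st.ρ (j + 1) *ᵥ (R + Y') ∧
          acc.2 = stab A st.ρ (j + 1) *ᵥ R + ρk • (stab A st.ρ j *ᵥ (A *ᵥ Y')))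
      (by omega) ?_ ⟨Y, hYK, hY, h1, h2⟩
    rintro s ⟨g, z⟩ hs1 hs2 ⟨Y, hYK, hY, h1, h2⟩
    obtain ⟨hsj, hsn⟩ := div_eq_of_mul_lt (n := n) (j := j) (s := s) (by omega) (by omega)
    have := orth_step hn hR.orth hs2 hsn (hRs s (by omega)) (hGs s (by omega)) (hc s (by omega))
      hY (Z := z) (by rw [hsj]; exact h2) _ rfl
    rw [hsj] at this
    refine ⟨_, Option.bind_eq_some_iff.2 ⟨_, safeDiv_eq_some (hc s (by omega)), rfl⟩,
      _, add_mem hYK (Submodule.smul_mem _ _ (hGK s (by omega))), this.2, ?_, this.1⟩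
    simp only at h1 ⊢
    rw [h1, (hGs s (by omega)).g_eq, stabCount_of_mod_ne hn hsn, hsj]
    simp only [Matrix.mulVec_add, Matrix.mulVec_smul, add_assoc]
  have hcj := hc (j * n) (by omega)
  have agree : ∀ (g w : Vec N) (d : ℕ → Vec N) (c : ℂ) (P : Prop), (∀ s ≤ k, d s = st.d s) →
      AgreeTo n k st { st with
        g := Function.update st.g (k + 1) g
        w := Function.update st.w (k + 1) w
        d := d
        c := Function.update st.c (k + 1) c
        stopped := P } := fun g w d c P hd =>
    { x := fun _ _ => rfl
      r := fun _ _ => rfl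
      u := fun _ _ => rfl
      g := fun s hs => Function.update_of_ne (by omega) _ _
      w := fun s hs => Function.update_of_ne (by omega) _ _
      d := hd
      c := fun s hs => Function.update_of_ne (by omega) _ _
      ρ := fun _ _ => rfl }
  by_cases hK : (k + 1) % n = 0
  · have hlt : ¬ rIdx n (k + 1) < n := by rw [rIdx_succ_lt_iff hn, not_not]; exact hK
    -- Here `k + 1 - n = j n`, so the shift already yields every relation below `j n` and no
    -- previous-block loop is needed.
    obtain ⟨Y, hYK, hY, hz, hg⟩ := mid 0 (st.r (k + 1)) (zero_mem _)
      (fun t ht => by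
        rw [add_zero, moment_mulVec hn]
        refine hR.orth _ ?_
        have := Nat.div_add_mod (k + 1) n
        have h1 : (k + 1) / n = j + 1 := by
          rw [Nat.succ_div, if_pos (Nat.dvd_of_mod_eq_zero hK)]
        rw [h1, mul_add, mul_comm n j] at this
        omega)
      (by rw [hR.r_eq, hcl]; simp) _ rfl
    rw [Matrix.mulVec_zero, zero_add] at hg
    obtain ⟨⟨g, z⟩, hloop, Y, hYK, hY, hg, hz⟩ := tail Y (_, _) hYK hY hg hz
    refine ⟨_, R + Y, ?_, Iff.rfl, agree g (A *ᵥ g) st.d (hdot (q ((k + 1) % n + 1)) (A *ᵥ g))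
      (st.r (k + 1) = 0) fun _ _ => rfl, hR.congr rfl rfl rfl fun _ _ => rfl, ?_⟩
    · rw [directionHalf, if_neg hlt]
      simp only [gIdx_succ, rIdx_succ, ← hj, ← hρk, safeDiv_eq_some hcj, safeDiv_eq_some hρ0,
        Option.bind_eq_bind, Option.bind_some, hloop]
    · constructor
      · simpa using hYK
      · exact hY
      · simpa [hcl] using hg
      · simp only at hg
        simp only [Function.update_self, hcl]
        rw [hg, mulVec_stab_mulVec]
      · exact fun h => (h hK).elim
      · simp [hK]
  · have hlt : rIdx n (k + 1) < n := by rw [rIdx_succ_lt_iff hn]; exact hK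
    have hKj : (k + 1) / n = j := succ_div_of_mod_ne hK
    have hu : st.u (k + 1) = stab A st.ρ j *ᵥ R := by rw [hR.u_eq hK, hKj]
    -- Orthogonalization against the previous block, whose tests use one stabilizing factor fewer;
    -- the loop also carries the images of `Y` and `A Y` under `stab A st.ρ j` for later use.
    have head : ∃ acc : Vec N × Vec N × Vec N,
        (if 1 ≤ j then
          forLoop (k + 1 - n) (j * n)
            (fun s (acc : Vec N × Vec N × Vec N) =>
              (safeDiv (-(hdot (q (s % n + 1)) acc.1)) (st.c s)).bind fun β =>
              some (acc.1 + β • st.d s, acc.2.1 + β • st.g s, acc.2.2 + β • st.w s))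
            (st.u (k + 1), 0, 0)
        else some (st.u (k + 1), 0, 0)) = some acc ∧
        ∃ Y ∈ krylov A (b - A *ᵥ x₀) (k + 1),
          (∀ t < j * n, moment n A q t (A *ᵥ (R + Y)) = 0) ∧
          acc.2.1 = stab A st.ρ j *ᵥ Y ∧ acc.2.2 = stab A st.ρ j *ᵥ (A *ᵥ Y) := by
      by_cases hj1 : 1 ≤ j
      · rw [if_pos hj1]
        obtain ⟨i, hi⟩ := Nat.exists_eq_add_of_le' hj1
        have hin : j * n = i * n + n := by rw [hi, Nat.succ_mul]
        have hkn' : k % n + 1 < n := by rwa [rIdx_succ] at hlt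
        have key := exists_forLoop (a := k + 1 - n) (e := j * n)
          (body := fun s (acc : Vec N × Vec N × Vec N) =>
              (safeDiv (-(hdot (q (s % n + 1)) acc.1)) (st.c s)).bind fun β =>
              some (acc.1 + β • st.d s, acc.2.1 + β • st.g s, acc.2.2 + β • st.w s))
          (fun m (acc : Vec N × Vec N × Vec N) => ∃ Y ∈ krylov A (b - A *ᵥ x₀) (k + 1),
            (∀ t < m, moment n A q t (A *ᵥ (R + Y)) = 0) ∧
            acc.1 = stab A st.ρ (i + 1) *ᵥ R + st.ρ (i + 1) • (stab A st.ρ i *ᵥ (A *ᵥ Y)) ∧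
            acc.2.1 = stab A st.ρ j *ᵥ Y ∧ acc.2.2 = stab A st.ρ j *ᵥ (A *ᵥ Y))
          (init := (st.u (k + 1), 0, 0)) (by omega) ?_
          ⟨0, zero_mem _, fun t ht => by
            rw [add_zero, moment_mulVec hn]
            exact hR.orth _ (by omega), by simp [hu, hi], by simp, by simp⟩
        · obtain ⟨acc, h1, Y, hYK, hY, -, h2, h3⟩ := key
          exact ⟨acc, h1, Y, hYK, hY, h2, h3⟩
        rintro s ⟨z, g, w⟩ hs1 hs2 ⟨Y, hYK, hY, h1, h2, h3⟩
        obtain ⟨hsj, hsn⟩ := div_eq_of_mul_lt (n := n) (j := i) (s := s) (by omega) (by omega)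
        have := orth_step hn hR.orth (show s < k + 1 by omega) hsn (hRs s (by omega))
          (hGs s (by omega)) (hc s (by omega)) hY (Z := z) (by rw [hsj]; exact h1) _ rfl
        rw [hsj] at this
        refine ⟨_, Option.bind_eq_some_iff.2 ⟨_, safeDiv_eq_some (hc s (by omega)), rfl⟩,
          _, add_mem hYK (Submodule.smul_mem _ _ (hGK s (by omega))), this.2, this.1, ?_, ?_⟩
        · simp only at h2 ⊢
          rw [h2, (hGs s (by omega)).g_eq, stabCount_of_mod_ne hn hsn, hsj, ← hi]
          simp only [Matrix.mulVec_add, Matrix.mulVec_smul]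
        · simp only at h3 ⊢
          rw [h3, (hGs s (by omega)).w_eq, stabCount_of_mod_ne hn hsn, hsj, ← hi]
          simp only [Matrix.mulVec_add, Matrix.mulVec_smul]
      · have hj0 : j = 0 := by omega
        rw [if_neg hj1]
        exact ⟨_, rfl, 0, zero_mem _, fun t ht => by simp [hj0] at ht, by simp, by simp⟩
    obtain ⟨⟨z₀, g₀, w₀⟩, hhead, Y, hYK, hY, hg₀, hw⟩ := head
    simp only at hg₀ hw
    obtain ⟨Y, hYK, hY, hz, hg⟩ := mid Y (st.r (k + 1) + ρk • w₀) hYK hY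
      (by rw [hR.r_eq, hcl, hw]) _ rfl
    rw [← hg₀] at hg
    obtain ⟨⟨g, z⟩, hloop, Y, hYK, hY, hg', hz⟩ := tail Y (_, _) hYK hY hg hz
    refine ⟨_, R + Y, ?_, Iff.rfl, agree g (A *ᵥ g)
      (Function.update st.d (k + 1) (z - st.u (k + 1)))
      (hdot (q ((k + 1) % n + 1)) (z - st.u (k + 1))) (st.r (k + 1) = 0)
      fun s hs => Function.update_of_ne (by omega) _ _, hR.congr rfl rfl rfl fun _ _ => rfl, ?_⟩
    · rw [directionHalf, if_pos hlt]
      simp only [gIdx_succ, rIdx_succ, ← hj, ← hρk, Option.bind_eq_bind]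
      split_ifs with hj1
      · rw [if_pos hj1] at hhead
        simp only [hhead, Option.bind_some, safeDiv_eq_some hcj, safeDiv_eq_some hρ0]
        rw [hloop]
        rfl
      · rw [if_neg hj1] at hhead
        simp only [hhead, Option.bind_some, safeDiv_eq_some hcj, safeDiv_eq_some hρ0]
        rw [hloop]
        rfl
    · simp only at hg' hz
      constructor
      · simpa using hYK
      · exact hY
      · simpa [hcl] using hg'
      · simp only [Function.update_self, hcl]
        rw [hg', mulVec_stab_mulVec]
      · intro _
        simp only [Function.update_self, hKj]
        rw [hz, hu, stab_succ_mulVec, Matrix.mulVec_add, Matrix.mulVec_add]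
        module
      · simp [hK]

end MLBiCGStab

/-! ### Absence of breakdown, and induction over the iterations -/

namespace MLBiCGStab

variable {N : ℕ} {n : ℕ} {A : Matrix (Fin N) (Fin N) ℂ} {b x₀ : Vec N} {q : ℕ → Vec N}
  {st : State N} {R G : Vec N} {k s ν : ℕ}

theorem forall_lt_succ_moment {v : Vec N} (h : ∀ t < s, moment n A q t v = 0)
    (hs : moment n A q s v = 0) : ∀ t < s + 1, moment n A q t v = 0 := fun t ht => by
  rcases Nat.lt_succ_iff_lt_or_eq.1 ht with ht | rfl
  · exact h t ht
  · exact hs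

/-- Otherwise `R ∈ K_{s+1}` would have `s + 1` vanishing moments and be zero, which a residual
polynomial excludes. -/
theorem IsResidual.moment_ne_zero (hR : IsResidual n A b x₀ q st s R)
    (hW : (momentW n A q (b - A *ᵥ x₀) (s + 1)).det ≠ 0) : moment n A q s R ≠ 0 := fun h =>
  ne_zero_of_sub_mem_map_krylov hW hR.mem
    (eq_zero_of_momentW hW hR.mem_krylov (forall_lt_succ_moment hR.orth h))

/-- Otherwise `S_{s+1}` forces `G = 0`; then `R` itself lies in `K_s`, and its `s` vanishing moments
force `R = 0` by `W_s`, a contradiction. -/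
theorem IsDirection.moment_ne_zero (hG : IsDirection n A b x₀ q st s R G)
    (hR : IsResidual n A b x₀ q st s R)
    (hW : ∀ l ≤ s + 1, (momentW n A q (b - A *ᵥ x₀) l).det ≠ 0)
    (hS : (momentS n A q (b - A *ᵥ x₀) (s + 1)).det ≠ 0) : moment n A q s (A *ᵥ G) ≠ 0 := by
  intro h
  have hG0 : G = 0 :=
    eq_zero_of_momentS hS (hG.mem_krylov hR) (forall_lt_succ_moment hG.orth h)
  have hRs : R ∈ krylov A (b - A *ᵥ x₀) s := by
    have := hG.mem
    rwa [hG0, zero_sub, neg_mem_iff] at this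
  exact ne_zero_of_sub_mem_map_krylov (hW _ le_rfl) hR.mem
    (eq_zero_of_momentW (hW s (by omega)) hRs hR.orth)

theorem IsDirection.hdot_d_ne_zero (hn : 1 ≤ n) (hs : s % n ≠ 0)
    (hG : IsDirection n A b x₀ q st s R G)
    (hR : IsResidual n A b x₀ q st s R) (h : moment n A q s (A *ᵥ G) ≠ 0) :
    hdot (q (s % n + 1)) (st.d s) ≠ 0 := by
  have hcl := stabCount_of_mod_ne hn hs
  rw [hG.d_eq hs, hdot_smul, hdot_stab_mulVec_moment hn hG.orth]
  exact mul_ne_zero (hR.ρ_ne _ (by omega)) (mul_ne_zero (prod_ρ_ne hR.ρ_ne (by omega)) h)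

theorem IsDirection.c_ne_zero (hn : 1 ≤ n) (hG : IsDirection n A b x₀ q st s R G)
    (hR : IsResidual n A b x₀ q st s R) (h : moment n A q s (A *ᵥ G) ≠ 0) : st.c s ≠ 0 := by
  rw [hG.c_eq]
  split_ifs with hs
  · have := hdot_stab_mulVec_moment (ρ := st.ρ) hn hG.orth
    rw [hs] at this
    rw [hG.w_eq, stabCount_of_mod_eq hn hs, this]
    exact mul_ne_zero (prod_ρ_ne hR.ρ_ne (div_le_stabCount hn s)) h
  · exact hG.hdot_d_ne_zero hn hs hR h

/-- Testing against `q_{i+1}` reaches only moments of index at most `n (s / n) + i < s`. This is the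
orthogonality in (d) and (e). -/
theorem hdot_stab_eq_zero {v : Vec N} {ρ : ℕ → ℂ} (hn : 1 ≤ n)
    (h : ∀ t < s, moment n A q t v = 0) {i : ℕ} (hi : i < s % n) :
    hdot (q (i + 1)) (stab A ρ (s / n) *ᵥ v) = 0 := by
  have h1 := Nat.div_add_mod s n
  have h2 := Nat.mod_lt s (show n > 0 by omega)
  have hm : (n * (s / n) + i) % n = i := by
    rw [Nat.mul_add_mod, Nat.mod_eq_of_lt (by omega)]
  have hd : (n * (s / n) + i) / n = s / n := by
    rw [Nat.mul_add_div (show n > 0 by omega), Nat.div_eq_of_lt (hi.trans h2), add_zero]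
  have := hdot_stab_mulVec_moment (ρ := ρ) hn (s := n * (s / n) + i) fun t ht => h t (by omega)
  rw [hm, hd, h _ (by omega), mul_zero] at this
  exact this

/-- The entries of the state with index at most `k` come from biorthogonal sequences. -/
def IsBiorthogonal (n : ℕ) (A : Matrix (Fin N) (Fin N) ℂ) (b x₀ : Vec N) (q : ℕ → Vec N)
    (st : State N) (k : ℕ) : Prop :=
  ∀ s ≤ k, ∃ R G, IsResidual n A b x₀ q st s R ∧ IsDirection n A b x₀ q st s R G

theorem isBiorthogonal_initState (hn : 1 ≤ n) :
    IsBiorthogonal n A b x₀ q (initState A b x₀ q) 0 := by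
  intro s hs
  obtain rfl : s = 0 := by omega
  have hcl : stabCount n 0 = 0 := by rw [stabCount_of_mod_eq hn (Nat.zero_mod n), Nat.zero_div]
  refine ⟨b - A *ᵥ x₀, b - A *ᵥ x₀, ⟨?_, ?_, ?_, ?_, ?_, ?_, ?_, ?_⟩, ⟨?_, ?_, ?_, ?_, ?_, ?_⟩⟩ <;>
    simp [initState, hcl, stab]

theorem IsBiorthogonal.agree {st' : State N} (hn : 1 ≤ n) (h : IsBiorthogonal n A b x₀ q st k)
    (ha : AgreeTo n k st st') : IsBiorthogonal n A b x₀ q st' k := fun s hs =>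
  let ⟨R, G, hR, hG⟩ := h s hs
  ⟨R, G, hR.agree ha hs, hG.agree hn ha hs⟩

theorem IsBiorthogonal.c_ne_zero (hn : 1 ≤ n) (h : IsBiorthogonal n A b x₀ q st k)
    (hW : ∀ l ≤ k + 1, (momentW n A q (b - A *ᵥ x₀) l).det ≠ 0)
    (hS : ∀ l ≤ k + 1, (momentS n A q (b - A *ᵥ x₀) l).det ≠ 0) : ∀ s ≤ k, st.c s ≠ 0 := by
  intro s hs
  obtain ⟨R, G, hR, hG⟩ := h s hs
  exact hG.c_ne_zero hn hR
    (hG.moment_ne_zero hR (fun l hl => hW l (by omega)) (hS _ (by omega)))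

theorem unlessStopped_eq {f : State N → Option (State N)} (h : ¬ st.stopped) :
    unlessStopped f st = f st := if_neg h

theorem IsBiorthogonal.directionHalf (hn : 1 ≤ n) (h : IsBiorthogonal n A b x₀ q st k)
    (hR : IsResidual n A b x₀ q st (k + 1) R) (hc : ∀ s ≤ k, st.c s ≠ 0) :
    ∃ st', directionHalf n A q (k + 1) st = some st' ∧ (st'.stopped ↔ st'.r (k + 1) = 0) ∧
      IsResidual n A b x₀ q st' (k + 1) R ∧ IsBiorthogonal n A b x₀ q st' (k + 1) := by
  choose! Rs Gs hRs hGs using h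
  obtain ⟨st', G, hd, hconv, ha, hR', hG'⟩ := directionHalf_eq_some hn hR hRs hGs hc
  refine ⟨st', hd, hconv, hR', fun s hs => ?_⟩
  rcases Nat.le_succ_iff.1 hs with hs | rfl
  · exact ⟨Rs s, Gs s, (hRs s hs).agree ha hs, (hGs s hs).agree hn ha hs⟩
  · exact ⟨R, G, hR', hG'⟩

theorem IsResidual.r_ne_zero (hR : IsResidual n A b x₀ q st s R)
    (hW : (momentW n A q (b - A *ᵥ x₀) (s + 1)).det ≠ 0) : st.r s ≠ 0 := by
  rw [hR.r_eq]
  exact mulVec_ne_zero_of_isUnit (isUnit_stab hR.ρ_unit)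
    (ne_zero_of_sub_mem_map_krylov hW hR.mem)

theorem run_of_lt (hn : 1 ≤ n)
    (hW : ∀ l ≤ ν, (momentW n A q (b - A *ᵥ x₀) l).det ≠ 0)
    (hS : ∀ l ≤ ν, (momentS n A q (b - A *ᵥ x₀) l).det ≠ 0)
    (hρ : ∀ k : ℕ, 1 ≤ k → k < ν → ∀ st : State N, runHalf n A b x₀ q k = some st → ¬ st.stopped →
      st.ρ (gIdx n k + 1) ≠ 0 ∧ -1 / st.ρ (gIdx n k + 1) ∉ spectrum ℂ A) (hk : k < ν) :
    ∃ st, run n A b x₀ q k = some st ∧ ¬ st.stopped ∧ IsBiorthogonal n A b x₀ q st k := by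
  induction k with
  | zero => exact ⟨_, rfl, ne_zero_of_sub_mem_map_krylov (hW (0 + 1) hk) (by simp),
      isBiorthogonal_initState hn⟩
  | succ k ih =>
    obtain ⟨st, hrun, hst, hB⟩ := ih (by omega)
    have hc := hB.c_ne_zero hn (fun l hl => hW l (by omega)) (fun l hl => hS l (by omega))
    obtain ⟨R, G, hR, hG⟩ := hB k le_rfl
    obtain ⟨st', R', hres, hst', ha, hR'⟩ : ∃ st' R', residualHalf n A q (k + 1) st = some st' ∧
        ¬ st'.stopped ∧ AgreeTo n k st st' ∧ IsResidual n A b x₀ q st' (k + 1) R' := by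
      by_cases hkn : k % n = 0
      · refine residualHalf_first hn hkn hR hG (hc k le_rfl) (fun R' hmem _ h0 => ?_) hst ?_
        -- Although `A` may be singular, `S_{k+2}` makes it injective on `K_{k+2}`, which contains
        -- `R'`.
        · refine ne_zero_of_sub_mem_map_krylov (hW _ hk) hmem
            (eq_zero_of_momentS (hS _ hk) (mem_krylov_of_sub_mem_map hmem) fun t _ => ?_)
          rw [h0]
          simp [moment, hdot_zero]
        · intro st' hst' hs
          obtain ⟨h1, h2⟩ := hρ (k + 1) (by omega) hk st'
            (by rw [runHalf, Nat.add_sub_cancel, hrun, Option.bind_some, unlessStopped_eq hst,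
              hst']) hs
          exact ⟨h1, isUnit_one_add_smul h1 h2⟩
      · exact residualHalf_next hn hkn hR hG (hc k le_rfl) hst
    obtain ⟨st'', hdir, hconv, hR'', hB''⟩ := (hB.agree hn ha).directionHalf hn hR'
      fun s hs => by rw [ha.c s hs]; exact hc s hs
    refine ⟨st'', ?_, ?_, hB''⟩
    · rw [run, hrun, Option.bind_some, unlessStopped_eq hst, hres, Option.bind_some,
        unlessStopped_eq hst', hdir]
    · rw [hconv]
      exact hR''.r_ne_zero (hW _ hk)

/-- If `n ∣ k` the run ends through `u = 0`. Otherwise the needed `ρ` is already available, the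
second half still runs safely, and the final test finds `r = 0`. Neither case needs a condition on a
new `ρ`. -/
theorem run_succ_terminal (hn : 1 ≤ n)
    (hν : krylov A (b - A *ᵥ x₀) (k + 1 + 1) ≤ krylov A (b - A *ᵥ x₀) (k + 1))
    (hW : ∀ l ≤ k + 1, (momentW n A q (b - A *ᵥ x₀) l).det ≠ 0)
    (hS : ∀ l ≤ k + 1, (momentS n A q (b - A *ᵥ x₀) l).det ≠ 0)
    (hrun : run n A b x₀ q k = some st) (hst : ¬ st.stopped)
    (hB : IsBiorthogonal n A b x₀ q st k) :
    ∃ st', run n A b x₀ q (k + 1) = some st' ∧ st'.stopped ∧ IsBiorthogonal n A b x₀ q st' k ∧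
      st'.r (k + 1) = 0 ∧ A *ᵥ st'.x (k + 1) = b := by
  have hc := hB.c_ne_zero hn hW hS
  obtain ⟨R, G, hR, hG⟩ := hB k le_rfl
  have hz : ∀ R', R' - (b - A *ᵥ x₀) ∈ (krylov A (b - A *ᵥ x₀) (k + 1)).map A.mulVecLin →
      (∀ t < k + 1, moment n A q t R' = 0) → R' = 0 := fun R' hmem horth =>
    eq_zero_of_momentW (hW _ le_rfl) (hν (mem_krylov_of_sub_mem_map hmem)) horth
  by_cases hkn : k % n = 0
  · obtain ⟨st', hres, hst', ha, hr, hx⟩ := residualHalf_terminal hn hkn hR hG (hc k le_rfl) hz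
    refine ⟨st', ?_, hst', hB.agree hn ha, hr, hx⟩
    rw [run, hrun, Option.bind_some, unlessStopped_eq hst, hres, Option.bind_some, unlessStopped,
      if_pos hst']
  · obtain ⟨st', R', hres, hst', ha, hR'⟩ := residualHalf_next hn hkn hR hG (hc k le_rfl) hst
    obtain ⟨st'', hdir, hconv, hR'', hB''⟩ := (hB.agree hn ha).directionHalf hn hR'
      fun s hs => by rw [ha.c s hs]; exact hc s hs
    have hr : st''.r (k + 1) = 0 := by
      rw [hR''.r_eq, hz R' hR''.mem hR''.orth, Matrix.mulVec_zero]
    refine ⟨st'', ?_, hconv.2 hr, fun s hs => hB'' s (by omega), hr, ?_⟩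
    · rw [run, hrun, Option.bind_some, unlessStopped_eq hst, hres, Option.bind_some,
        unlessStopped_eq hst', hdir]
    · have := hR''.x_res
      rw [hr] at this
      exact (sub_eq_zero.1 this).symm

end MLBiCGStab

/-! ### Assembly of the proposition -/

theorem mainTheorem3 {N : ℕ} (n : ℕ) (hn : 1 ≤ n) (A : Matrix (Fin N) (Fin N) ℂ)
    (b x₀ : Vec N) (q : ℕ → Vec N)
    (r₀ : Vec N) (hr₀ : r₀ = b - A *ᵥ x₀)
    (ν : ℕ) (hν : ν = minPolyDegree A r₀)
    (hdet : ∏ l ∈ Finset.Icc 1 ν, (momentS n A q r₀ l).det * (momentW n A q r₀ l).det ≠ 0)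
    (hρ : ∀ k : ℕ, 1 ≤ k → k < ν → ∀ st : State N, runHalf n A b x₀ q k = some st → ¬ st.stopped →
      st.ρ (gIdx n k + 1) ≠ 0 ∧ -1 / st.ρ (gIdx n k + 1) ∉ spectrum ℂ A) :
    -- no division by zero in iterations `1, …, ν`, and the algorithm stops exactly at iteration `ν`
    (∀ k : ℕ, k ≤ ν → ∃ st : State N, run n A b x₀ q k = some st ∧ (st.stopped ↔ k = ν)) ∧
    ∀ st : State N, run n A b x₀ q ν = some st →
      A *ᵥ st.x ν = b ∧
      (∀ k : ℕ, 1 ≤ k → k < ν →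
        st.x k - x₀ ∈ krylov A r₀ (gIdx n k + k + 1) ∧
        st.r k = b - A *ᵥ st.x k ∧
        st.r k - r₀ ∈ (krylov A r₀ (gIdx n k + k + 1)).map A.mulVecLin) ∧
      ((∀ k : ℕ, 1 ≤ k → k < ν → st.r k ≠ 0) ∧ st.r ν = 0) ∧
      (∀ k : ℕ, 1 ≤ k → k < ν → rIdx n k = n → hdot (st.r k) (q 1) ≠ 0) ∧
      (∀ k : ℕ, 1 ≤ k → k < ν → rIdx n k < n →
        (∀ v ∈ Submodule.span ℂ (q '' Set.Icc 1 (rIdx n k)), hdot (st.u k) v = 0) ∧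
        hdot (st.u k) (q (rIdx n k + 1)) ≠ 0) ∧
      (∀ k : ℕ, 1 ≤ k → k < ν → rIdx n k < n →
        (∀ v ∈ Submodule.span ℂ (q '' Set.Icc 1 (rIdx n k)), hdot (st.d k) v = 0) ∧
        hdot (st.d k) (q (rIdx n k + 1)) ≠ 0) := by
  subst hr₀
  have hSW : ∀ l ≤ ν, (momentS n A q (b - A *ᵥ x₀) l).det ≠ 0 ∧
      (momentW n A q (b - A *ᵥ x₀) l).det ≠ 0 := by
    intro l hl
    -- The product omits `l = 0`, which is also needed; the empty determinant is 1.
    rcases Nat.eq_zero_or_pos l with rfl | h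
    · simp
    · exact mul_ne_zero_iff.1 (Finset.prod_ne_zero_iff.1 hdet l (Finset.mem_Icc.2 ⟨h, hl⟩))
  have hS := fun l hl => (hSW l hl).1
  have hW := fun l hl => (hSW l hl).2
  have hlt := fun k (hk : k < ν) => run_of_lt hn hW hS hρ hk
  have hend : ∃ st, run n A b x₀ q ν = some st ∧ st.stopped ∧
      (∀ k < ν, ∃ R G, IsResidual n A b x₀ q st k R ∧ IsDirection n A b x₀ q st k R G) ∧
      st.r ν = 0 ∧ A *ᵥ st.x ν = b := by
    obtain _ | k := ν
    -- For `ν = 0` the initial state has already stopped.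
    · have h0 : b - A *ᵥ x₀ = 0 := by
        have := krylov_succ_minPolyDegree A (b - A *ᵥ x₀)
        rw [← hν] at this
        exact eq_zero_of_mem_krylov_zero (this (self_mem_krylov _ (by omega)))
      refine ⟨_, rfl, h0, fun k hk => absurd hk (by omega), ?_, ?_⟩
      · simpa [initState] using h0
      · simpa [initState] using (sub_eq_zero.1 h0).symm
    · obtain ⟨st, hrun, hst, hB⟩ := hlt k (by omega)
      obtain ⟨st', h1, h2, h3, h4⟩ := run_succ_terminal hn
        (by have := krylov_succ_minPolyDegree A (b - A *ᵥ x₀); rwa [← hν] at this)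
        hW hS hrun hst hB
      exact ⟨st', h1, h2, fun k hk => h3 k (by omega), h4⟩
  obtain ⟨st, hrun, hst, hB, hr, hx⟩ := hend
  refine ⟨fun k hk => ?_, fun st' hst' => ?_⟩
  · rcases hk.lt_or_eq with hk | rfl
    · obtain ⟨st, h1, h2, -⟩ := hlt k hk
      exact ⟨st, h1, iff_of_false h2 hk.ne⟩
    · exact ⟨st, hrun, iff_of_true hst rfl⟩
  obtain rfl : st = st' := Option.some.inj (hrun.symm.trans hst')
  have hmod : ∀ k, 1 ≤ k → rIdx n k < n → k % n ≠ 0 ∧ rIdx n k = k % n := by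
    intro k hk h
    obtain ⟨m, rfl⟩ := Nat.exists_eq_add_of_le' hk
    have h1 := (rIdx_succ_lt_iff hn m).1 h
    refine ⟨h1, ?_⟩
    rw [rIdx, gIdx_succ, ← succ_div_of_mod_ne h1]
    have := Nat.div_add_mod (m + 1) n
    omega
  refine ⟨hx, fun k hk hkν => ?_, ⟨fun k hk hkν => ?_, hr⟩, fun k hk hkν hkn => ?_,
    fun k hk hkν hkn => ?_, fun k hk hkν hkn => ?_⟩ <;> obtain ⟨R, G, hR, hG⟩ := hB k hkν
  · have hcl : gIdx n k + k + 1 = k + stabCount n k := by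
      obtain ⟨m, rfl⟩ := Nat.exists_eq_add_of_le' hk
      rw [stabCount_succ hn, gIdx_succ]; omega
    rw [hcl]
    refine ⟨hR.x_mem, hR.x_res.symm, -(st.x k - x₀), neg_mem hR.x_mem, ?_⟩
    rw [← hR.x_res, Matrix.mulVecLin_apply, Matrix.mulVec_neg, Matrix.mulVec_sub]
    abel
  · exact hR.r_ne_zero (hW _ hkν)
  · have hk0 : k % n = 0 := by
      by_contra h
      obtain ⟨m, rfl⟩ := Nat.exists_eq_add_of_le' hk
      have := (rIdx_succ_lt_iff hn m).2 h
      omega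
    -- For `n ∣ k` the residual carries exactly `k / n` factors, so testing it with `q 1` gives the
    -- moment of index `k`.
    rw [Ne, hdot_eq_zero_comm, hR.r_eq, stabCount_of_mod_eq hn hk0]
    have := hdot_stab_mulVec_moment (ρ := st.ρ) hn hR.orth
    rw [hk0] at this
    rw [this]
    exact mul_ne_zero (prod_ρ_ne hR.ρ_ne (div_le_stabCount hn k)) (hR.moment_ne_zero (hW _ hkν))
  · obtain ⟨hk0, hrk⟩ := hmod k hk hkn
    rw [hrk, hR.u_eq hk0]
    refine ⟨fun v hv => hdot_eq_zero_of_mem_span ?_ hv, ?_⟩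
    · rintro _ ⟨i, ⟨hi1, hi2⟩, rfl⟩
      obtain ⟨i, rfl⟩ := Nat.exists_eq_add_of_le' hi1
      exact hdot_stab_eq_zero hn hR.orth hi2
    · rw [Ne, hdot_eq_zero_comm, hdot_stab_mulVec_moment hn hR.orth]
      exact mul_ne_zero (prod_ρ_ne hR.ρ_ne (div_le_stabCount hn k)) (hR.moment_ne_zero (hW _ hkν))
  · obtain ⟨hk0, hrk⟩ := hmod k hk hkn
    rw [hrk]
    refine ⟨fun v hv => hdot_eq_zero_of_mem_span ?_ hv, ?_⟩
    · rintro _ ⟨i, ⟨hi1, hi2⟩, rfl⟩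
      obtain ⟨i, rfl⟩ := Nat.exists_eq_add_of_le' hi1
      rw [hG.d_eq hk0, hdot_smul, hdot_stab_eq_zero hn hG.orth hi2, mul_zero]
    · rw [Ne, hdot_eq_zero_comm]
      exact hG.hdot_d_ne_zero hn hk0 hR
        (hG.moment_ne_zero hR (fun l hl => hW l (by omega)) (hS _ hkν))
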